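/- All matroids are finite. For a matroid $M$ with ground set $E_M$, $N=|E_M|$, rank function $\mathrm{rk}$ and corank $\ell(\gamma)=|\gamma|-\mathrm{rk}(\gamma)$, and for indices $\vec a=(a_x)_{x\in E_M}$, let $\omega(\gamma)=\sum_{x\in\gamma}a_x-\tfrac d2\,\ell(\gamma)$ for $\gamma\subseteq E_M$. If $\ell(E_M)>0$, the dimension $d$ is determined by $\omega(E_M)=0$, i.e. $\tfrac d2=\frac1{\ell(E_M)}\sum_{x\in E_M}a_x$. The Hepp bound and the position-space Hepp bound of $M$ are $$\mathcal H(M,\vec a)=\sum_{\sigma}\prod_{k=1}^{N-1}\frac1{\omega(\{\sigma(1),\dots,\sigma(k)\})},\qquad \hat{\mathcal H}(M,\vec a)=\frac{\prod_{x\in E_M}a_x^\star}{d/2}\,\mathcal H(M,\vec a),\qquad a_x^\star=\tfrac d2-a_x,$$ where $\sigma$ runs over all $N!$ orderings of $E_M$. A matroid is connected if it is not a direct sum of two matroids with non-empty ground sets. Let $A$ and $B$ be connected matroids with at least $3$ elements each, and let $e\in A$, $f\in B$. The 2-sum $M=A\oplus_{e,f}B$ is the matroid on the disjoint union of $E_A\setminus\{e\}$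 and $E_B\setminus\{f\}$ whose bases are the sets $S\sqcup T$ such that either $S$ is a basis of $A\setminus e$ and $T$ is a basis of $B/f$, or $S$ is a basis of $A/e$ and $T$ is a basis of $B\setminus f$. **Product formula.** Let $\vec a$ and $\vec b$ be independent variables indexed by the elements of $A\setminus e$ and of $B\setminus f$, let $d$ be the dimension determined by $M$ and $(\vec a,\vec b)$, and set $a_e:=\omega(B\setminus f)$ and $b_f:=\omega(A\setminus e)$ in this dimension. Then, as an identity in the field of rational functions in $(\vec a,\vec b)$ over $\mathbb Q$, in which none of the denominators occurring in the three terms vanishes, $$\hat{\mathcal H}(M,\vec a,\vec b)=\hat{\mathcal H}(A,\vec a,a_e)\cdot\hat{\mathcal H}(B,\vec b,b_f).$$ **Series–parallel reductions.** Let $U_{3,r}$ be the uniform matroid of rank $r$ on $\{1,2,3\}$. Let $S=A\oplus_{e,3}U_{3,2}$, with variables $\vec a$ on $A\setminus e$ and $a_1,a_2$ on the elements $1,2$ ($e$ is replaced by two elements in series). Then $$\mathcal H(S,a_1,a_2,\vec a)=\frac{a_1+a_2}{a_1a_2}\,\mathcal H(A,\vec a,a_1+a_2),$$ where the last argument is the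 index of $e$. Let $P=A\oplus_{e,3}U_{3,1}$ ($e$ is replaced by two parallel elements), with $d$ the dimension determined by $P$ and $(\vec a,a_1,a_2)$. Then $$\mathcal H(P,a_1,a_2,\vec a)=\frac{a_1^\star+a_2^\star}{a_1^\star a_2^\star}\,\mathcal H(A,\vec a,a_1+a_2-\tfrac d2),\qquad \hat{\mathcal H}(P,a_1,a_2,\vec a)=\hat{\mathcal H}(A,\vec a,a_1+a_2-\tfrac d2).$$ -/

import Mathlib

namespace HeppBound

open Set

/-- A matroid is disconnected if it is a direct sum of two matroids with non-empty ground sets;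
otherwise it is connected. -/
def IsConnected {α : Type*} (M : Matroid α) : Prop :=
  ¬ ∃ (A B : Matroid α) (h : Disjoint A.E B.E),
      A.E.Nonempty ∧ B.E.Nonempty ∧ M = A.disjointSum B h

/-- The data that may enter a 2-sum: a connected finite matroid with at least three elements,
together with a chosen element `e`. -/
structure TwoSummand {α : Type*} (A : Matroid α) (e : α) : Prop where
  connected : IsConnected A
  finite : A.Finite
  three_le : 3 ≤ A.E.ncard
  mem : e ∈ A.E

theorem disconnected_of_split {α : Type*} {A : Matroid α} {e : α} (he : e ∈ A.E)
    (hne : (A.E \ {e}).Nonempty)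
    (h : ∀ I ⊆ A.E, A.Indep I ↔ A.Indep (I ∩ {e}) ∧ A.Indep (I ∩ (A.E \ {e}))) :
    ¬ IsConnected A := by
  have hd : Disjoint (A.restrict {e}).E (A.restrict (A.E \ {e})).E := by
    rw [Matroid.restrict_ground_eq, Matroid.restrict_ground_eq]
    exact disjoint_sdiff_right
  have hu : {e} ∪ (A.E \ {e}) = A.E := Set.union_sdiff_cancel (Set.singleton_subset_iff.2 he)
  refine not_not.2 ⟨A.restrict {e}, A.restrict (A.E \ {e}), hd, ⟨e, rfl⟩, hne, ?_⟩
  refine Matroid.ext_indep ?_ ?_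
  · rw [Matroid.disjointSum_ground_eq, Matroid.restrict_ground_eq, Matroid.restrict_ground_eq, hu]
  · intro I hI
    rw [h I hI, Matroid.disjointSum_indep_iff, Matroid.restrict_ground_eq,
      Matroid.restrict_ground_eq, Matroid.restrict_indep_iff, Matroid.restrict_indep_iff, hu]
    exact ⟨fun h => ⟨⟨h.1, inter_subset_right⟩, ⟨h.2, inter_subset_right⟩, hI⟩,
      fun h => ⟨h.1.1, h.2.1.1⟩⟩

theorem TwoSummand.diff_nonempty {α : Type*} {A : Matroid α} {e : α} (h : TwoSummand A e) :
    (A.E \ {e}).Nonempty := by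
  by_contra hcon
  have h1 : A.E ⊆ {e} := by
    rw [Set.not_nonempty_iff_eq_empty, Set.sdiff_eq_empty] at hcon
    exact hcon
  have h2 := Set.ncard_le_ncard h1 (Set.finite_singleton e)
  have h3 := h.three_le
  rw [Set.ncard_singleton] at h2
  omega

theorem TwoSummand.indep {α : Type*} {A : Matroid α} {e : α} (h : TwoSummand A e) :
    A.Indep {e} := by
  by_contra hcon
  have hl : A.IsLoop e := (Matroid.singleton_not_indep h.mem).1 hcon
  refine disconnected_of_split h.mem h.diff_nonempty ?_ h.connected
  intro I hI
  constructor
  · intro hI'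
    exact ⟨hI'.subset inter_subset_left, hI'.subset inter_subset_left⟩
  · rintro ⟨h1, h2⟩
    have heI : e ∉ I := fun heI => hl.notMem_of_indep h1 ⟨heI, rfl⟩
    refine h2.subset fun x hx => ⟨hx, hI hx, ?_⟩
    rintro rfl
    exact heI hx

theorem TwoSummand.coindep {α : Type*} {A : Matroid α} {e : α} (h : TwoSummand A e) :
    A.Coindep {e} := by
  have hnc : ¬ A.IsColoop e := by
    intro hc
    refine disconnected_of_split h.mem h.diff_nonempty ?_ h.connected
    intro I hI
    constructor
    · intro hI'
      exact ⟨hI'.subset inter_subset_left, hI'.subset inter_subset_left⟩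
    · rintro ⟨-, h2⟩
      obtain ⟨B, hB, hIB⟩ := h2.exists_isBase_superset
      refine hB.indep.subset fun x hx => ?_
      by_cases hxe : x = e
      · subst hxe
        exact hc.mem_of_isBase hB
      · exact hIB ⟨hx, hI hx, hxe⟩
  have : A.dual.Indep {e} := by
    by_contra hcon
    exact hnc ((Matroid.singleton_not_indep (M := A.dual) h.mem).1 hcon)
  exact this

/-- The ground set of the 2-sum: the disjoint union of `E_A ∖ e` and `E_B ∖ f`. -/
def twoSumGround {α β : Type*} (A : Matroid α) (B : Matroid β) (e : α) (f : β) : Set (α ⊕ β) :=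
  Sum.inl '' (A.E \ {e}) ∪ Sum.inr '' (B.E \ {f})

/-- The bases `S ⊔ T` of the 2-sum, where either `S` is a base of `A ∖ e` and `T` one of `B / f`,
or `S` is a base of `A / e` and `T` one of `B ∖ f`. -/
def TwoSumIsBase {α β : Type*} (A : Matroid α) (B : Matroid β) (e : α) (f : β)
    (X : Set (α ⊕ β)) : Prop :=
  ((A.delete {e}).IsBase (Sum.inl ⁻¹' X) ∧ (B.contract {f}).IsBase (Sum.inr ⁻¹' X)) ∨
  ((A.contract {e}).IsBase (Sum.inl ⁻¹' X) ∧ (B.delete {f}).IsBase (Sum.inr ⁻¹' X))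

theorem twoSumIsBase_subset {α β : Type*} {A : Matroid α} {B : Matroid β} {e : α} {f : β}
    {X : Set (α ⊕ β)} (h : TwoSumIsBase A B e f X) : X ⊆ twoSumGround A B e f := by
  rintro (x | y) hx
  · left
    refine ⟨x, ?_, rfl⟩
    rcases h with h | h
    · exact h.1.subset_ground hx
    · exact h.1.subset_ground hx
  · right
    refine ⟨y, ?_, rfl⟩
    rcases h with h | h
    · exact h.2.subset_ground hx
    · exact h.2.subset_ground hx

theorem twoSumIsBase_iff {α β : Type*} {A : Matroid α} {B : Matroid β} {e : α} {f : β}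
    (hA : TwoSummand A e) (hB : TwoSummand B f) (X : Set (α ⊕ β)) :
    TwoSumIsBase A B e f X ↔ Sum.inl e ∉ X ∧ Sum.inr f ∉ X ∧
      ((A.sum B).IsBase (insert (Sum.inl e) X) ∨ (A.sum B).IsBase (insert (Sum.inr f) X)) := by
  have e1 : (Sum.inl ⁻¹' (insert (Sum.inl e) X) : Set α) = Sum.inl ⁻¹' X ∪ {e} := by
    ext x; simp
  have e2 : (Sum.inr ⁻¹' (insert (Sum.inl e) X) : Set β) = Sum.inr ⁻¹' X := by
    ext x; simp
  have e3 : (Sum.inl ⁻¹' (insert (Sum.inr f) X) : Set α) = Sum.inl ⁻¹' X := by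
    ext x; simp
  have e4 : (Sum.inr ⁻¹' (insert (Sum.inr f) X) : Set β) = Sum.inr ⁻¹' X ∪ {f} := by
    ext x; simp
  rw [TwoSumIsBase, hA.coindep.delete_isBase_iff, hB.coindep.delete_isBase_iff,
    hA.indep.contract_isBase_iff, hB.indep.contract_isBase_iff, Matroid.sum_isBase_iff,
    Matroid.sum_isBase_iff, e1, e2, e3, e4, Set.disjoint_singleton_right,
    Set.disjoint_singleton_right]
  simp only [mem_preimage]
  tauto

theorem twoSum_exchange {α β : Type*} {A : Matroid α} {B : Matroid β} {e : α} {f : β}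
    (hA : TwoSummand A e) (hB : TwoSummand B f) :
    Matroid.ExchangeProperty (TwoSumIsBase A B e f) := by
  have key : ∀ (p q : α ⊕ β) (X X' : Set (α ⊕ β)), p ∉ X → q ∉ X → p ∉ X' → q ∉ X' →
      (A.sum B).IsBase (insert p X) →
      ((A.sum B).IsBase (insert p X') ∨ (A.sum B).IsBase (insert q X')) →
      ∀ x ∈ X \ X', ∃ y ∈ X' \ X, ((A.sum B).IsBase (insert p (insert y (X \ {x}))) ∨
        (A.sum B).IsBase (insert q (insert y (X \ {x})))) := by
    intro p q X X' hp hq hp' hq' hX hX' x hx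
    have hxp : x ≠ p := fun h => hp (h ▸ hx.1)
    have hxq : x ≠ q := fun h => hq (h ▸ hx.1)
    rcases hX' with hX' | hX'
    · obtain ⟨y, hy, hb⟩ := hX.exchange hX' (e := x)
        ⟨mem_insert_of_mem _ hx.1, fun h => h.elim hxp hx.2⟩
      have hyp : y ≠ p := fun h => hy.2 (h ▸ mem_insert _ _)
      refine ⟨y, ⟨hy.1.resolve_left hyp, fun h => hy.2 (mem_insert_of_mem _ h)⟩, Or.inl ?_⟩
      rwa [insert_comm, insert_sdiff_singleton_comm hxp.symm]
    · obtain ⟨y, hy, hb⟩ := hX.exchange hX' (e := x)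
        ⟨mem_insert_of_mem _ hx.1, fun h => h.elim hxq hx.2⟩
      rw [← insert_sdiff_singleton_comm hxp.symm] at hb
      by_cases hyq : y = q
      · subst hyq
        have hpy : p ≠ y := fun h => hy.2 (h ▸ mem_insert _ _)
        obtain ⟨z, hz, hb'⟩ := hb.exchange hX' (e := p)
          ⟨mem_insert_of_mem _ (mem_insert _ _), fun h => h.elim hpy hp'⟩
        have hzy : z ≠ y := fun h => hz.2 (h ▸ mem_insert _ _)
        have hzX' : z ∈ X' := hz.1.resolve_left hzy
        have hzx : z ≠ x := fun h => hx.2 (h ▸ hzX')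
        refine ⟨z, ⟨hzX', fun h => hz.2 ?_⟩, Or.inr ?_⟩
        · exact mem_insert_of_mem _ (mem_insert_of_mem _ ⟨h, hzx⟩)
        · have : insert y (insert p (X \ {x})) \ {p} = insert y (X \ {x}) := by
            rw [← insert_sdiff_singleton_comm hpy.symm, insert_sdiff_of_mem _ (mem_singleton p),
              sdiff_singleton_eq_self]
            exact fun h => hp h.1
          rw [this] at hb'
          rwa [insert_comm]
      · refine ⟨y, ⟨hy.1.resolve_left hyq, fun h => hy.2 (mem_insert_of_mem _ h)⟩, Or.inl ?_⟩
        rwa [insert_comm]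
  intro X X' hX hX' x hx
  rw [twoSumIsBase_iff hA hB] at hX hX'
  obtain ⟨h1, h2, h3⟩ := hX
  obtain ⟨h1', h2', h3'⟩ := hX'
  have fin : ∀ y ∈ X' \ X, ((A.sum B).IsBase (insert (Sum.inl e) (insert y (X \ {x}))) ∨
      (A.sum B).IsBase (insert (Sum.inr f) (insert y (X \ {x})))) →
      TwoSumIsBase A B e f (insert y (X \ {x})) := by
    intro y hy hb
    rw [twoSumIsBase_iff hA hB]
    refine ⟨?_, ?_, hb⟩
    · rintro (h | h)
      · exact h1' (h ▸ hy.1)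
      · exact h1 h.1
    · rintro (h | h)
      · exact h2' (h ▸ hy.1)
      · exact h2 h.1
  rcases h3 with h3 | h3
  · obtain ⟨y, hy, hb⟩ := key _ _ X X' h1 h2 h1' h2' h3 h3' x hx
    exact ⟨y, hy, fin y hy hb⟩
  · obtain ⟨y, hy, hb⟩ := key _ _ X X' h2 h1 h2' h1' h3 h3'.symm x hx
    exact ⟨y, hy, fin y hy hb.symm⟩

theorem twoSum_exists_isBase {α β : Type*} (A : Matroid α) (B : Matroid β) (e : α) (f : β) :
    ∃ X, TwoSumIsBase A B e f X := by
  obtain ⟨S, hS⟩ := (A.delete {e}).exists_isBase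
  obtain ⟨T, hT⟩ := (B.contract {f}).exists_isBase
  refine ⟨Sum.inl '' S ∪ Sum.inr '' T, Or.inl ⟨?_, ?_⟩⟩
  · convert hS using 1
    ext x; simp
  · convert hT using 1
    ext x; simp

theorem twoSumGround_finite {α β : Type*} {A : Matroid α} {B : Matroid β} {e : α} {f : β}
    (hA : TwoSummand A e) (hB : TwoSummand B f) : (twoSumGround A B e f).Finite :=
  ((hA.finite.ground_finite.sdiff).image _).union ((hB.finite.ground_finite.sdiff).image _)

/-- The 2-sum `A ⊕_{e,f} B`. -/
def twoSum {α β : Type*} {A : Matroid α} {B : Matroid β} {e : α} {f : β}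
    (hA : TwoSummand A e) (hB : TwoSummand B f) : Matroid (α ⊕ β) :=
  Matroid.ofIsBaseOfFinite (twoSumGround_finite hA hB) (TwoSumIsBase A B e f)
    (twoSum_exists_isBase A B e f) (twoSum_exchange hA hB) (fun _ h => twoSumIsBase_subset h)

/-- The uniform matroid of rank `min r n` on `n` elements (of rank `r` if `r ≤ n`): its
independent sets are the sets of size at most `r`. -/
def uniform (n r : ℕ) : Matroid (Fin n) :=
  (IndepMatroid.ofFinite (Set.finite_univ (α := Fin n)) (fun I => I.ncard ≤ r)
    (by simp)
    (fun I J hJ hIJ => (Set.ncard_le_ncard hIJ J.toFinite).trans hJ)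
    (fun I J _ hJ hIJ => by
      obtain ⟨x, hx, hx'⟩ := Set.exists_mem_notMem_of_ncard_lt_ncard hIJ I.toFinite
      refine ⟨x, hx, hx', ?_⟩
      rw [Set.ncard_insert_of_notMem hx' I.toFinite]
      omega)
    (fun _ _ => Set.subset_univ _)).matroid

theorem uniform_indep_iff {n r : ℕ} {I : Set (Fin n)} : (uniform n r).Indep I ↔ I.ncard ≤ r :=
  Iff.rfl

theorem uniform_twoSummand {r : ℕ} (h0 : 0 < r) (h3 : r < 3) (i : Fin 3) :
    TwoSummand (uniform 3 r) i where
  finite := ⟨Set.toFinite _⟩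
  three_le := by
    have : (uniform 3 r).E = Set.univ := rfl
    simp [this, Set.ncard_univ]
  mem := Set.mem_univ _
  connected := by
    rintro ⟨A, B, h, hA, hB, heq⟩
    have hE : A.E ∪ B.E = Set.univ := by
      have h1 : (uniform 3 r).E = Set.univ := rfl
      rw [heq] at h1
      simpa using h1
    have hI : ∀ I : Set (Fin 3), I.ncard ≤ r ↔
        (I ∩ A.E).ncard ≤ r ∧ (I ∩ B.E).ncard ≤ r := by
      have hi : ∀ I : Set (Fin 3), I.ncard ≤ r ↔ A.Indep (I ∩ A.E) ∧ B.Indep (I ∩ B.E) := by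
        intro I
        rw [← uniform_indep_iff, heq, Matroid.disjointSum_indep_iff, hE]
        simp
      intro I
      constructor
      · intro hI
        exact ⟨(Set.ncard_le_ncard inter_subset_left I.toFinite).trans hI,
          (Set.ncard_le_ncard inter_subset_left I.toFinite).trans hI⟩
      · rintro ⟨h1, h2⟩
        rw [hi]
        refine ⟨?_, ?_⟩
        · have := ((hi _).1 h1).1
          rwa [inter_assoc, inter_self] at this
        · have := ((hi _).1 h2).2
          rwa [inter_assoc, inter_self] at this
    have hcard : A.E.ncard + B.E.ncard = 3 := by
      rw [← Set.ncard_union_eq h A.E.toFinite B.E.toFinite, hE]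
      simp [Set.ncard_univ]
    have hA1 : 0 < A.E.ncard := (Set.ncard_pos A.E.toFinite).2 hA
    have hB1 : 0 < B.E.ncard := (Set.ncard_pos B.E.toFinite).2 hB
    by_cases hr : r = 1
    · obtain ⟨x, hx⟩ := hA
      obtain ⟨y, hy⟩ := hB
      have hxy : x ≠ y := fun hxy => Set.disjoint_left.1 h hx (hxy ▸ hy)
      have hyA : y ∉ A.E := fun hyA => Set.disjoint_left.1 h hyA hy
      have hxB : x ∉ B.E := fun hxB => Set.disjoint_left.1 h hx hxB
      have := (hI {x, y}).2 ⟨by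
          rw [Set.insert_inter_of_mem hx, Set.singleton_inter_eq_empty.2 hyA]
          simp; omega, by
          rw [Set.insert_inter_of_notMem hxB]
          exact (Set.ncard_le_ncard inter_subset_left (Set.finite_singleton y)).trans
            (by simp; omega)⟩
      rw [Set.ncard_pair hxy] at this
      omega
    · have := (hI Set.univ).2 ⟨by rw [univ_inter]; omega, by rw [univ_inter]; omega⟩
      simp [Set.ncard_univ] at this
      omega

/-- The corank (loop number) `ℓ(γ) = |γ| - rk(γ)` of a finite set `γ`. -/
noncomputable def corank {α : Type*} (M : Matroid α) (γ : Set α) : ℕ :=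
  γ.ncard - (M.eRk γ).toNat

/-- The superficial degree of convergence `∑_{x ∈ γ} a_x - h ℓ(γ)`, where `h = d/2`. -/
noncomputable def sdc {α K : Type*} [Field K] (M : Matroid α) (h : K) (a : α → K)
    (γ : Set α) : K :=
  (∑ᶠ x ∈ γ, a x) - h * (corank M γ : K)

/-- Half of the dimension in which `M` is logarithmically divergent: for a matroid `M` of positive
corank this is the unique `h` with `sdc M h a M.E = 0`. -/
noncomputable def halfDim {α K : Type*} [Field K] (M : Matroid α) (a : α → K) : K :=
  (∑ᶠ x ∈ M.E, a x) / (corank M M.E : K)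

/-- The set of the first `k` edges in the order `σ` of the ground set. -/
def initialSet {α : Type*} {E : Set α} {n : ℕ} (σ : Fin n ≃ E) (k : ℕ) : Set α :=
  {x | ∃ i : Fin n, i.val < k ∧ (σ i : α) = x}

/-- The Hepp bound: the sum over all orders `σ` of the edges of the product of the inverse
superficial degrees of convergence of the first `k` edges, for `1 ≤ k ≤ N - 1`, in the dimension
where `M` is logarithmically divergent. -/
noncomputable def hepp {α K : Type*} [Field K] (M : Matroid α) (a : α → K) : K :=
  ∑ᶠ σ : Fin M.E.ncard ≃ M.E,
    ∏ k ∈ Finset.Ico 1 M.E.ncard, (sdc M (halfDim M a) a (initialSet σ k))⁻¹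

/-- The Hepp bound in position space, `(∏ₑ aₑ⋆) / (d/2)` times the Hepp bound, where
`aₑ⋆ = d/2 - aₑ`. -/
noncomputable def heppPos {α K : Type*} [Field K] (M : Matroid α) (a : α → K) : K :=
  (∏ᶠ x ∈ M.E, (halfDim M a - a x)) / halfDim M a * hepp M a

/-- None of the denominators in the definitions of `hepp M a` and `heppPos M a` is zero. -/
def DenominatorsNonzero {α K : Type*} [Field K] (M : Matroid α) (a : α → K) : Prop :=
  (corank M M.E : K) ≠ 0 ∧ halfDim M a ≠ 0 ∧
    ∀ γ : Set α, γ.Nonempty → γ ⊂ M.E → sdc M (halfDim M a) a γ ≠ 0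

/-- The field of rational functions over `ℚ` in variables indexed by the edges of `M`. -/
abbrev IndexField {α : Type*} (M : Matroid α) : Type _ :=
  FractionRing (MvPolynomial M.E ℚ)

open Classical in
/-- The indeterminate indices of the edges of `M` (and `0` off the ground set). -/
noncomputable def varIndex {α : Type*} (M : Matroid α) (x : α) : IndexField M :=
  if hx : x ∈ M.E then algebraMap (MvPolynomial M.E ℚ) (IndexField M) (MvPolynomial.X ⟨x, hx⟩)
  else 0

end HeppBound

/-! Write `X` and `Y` for the ground sets of `A ∖ e` and `B ∖ f`, and `u`, `v` for the functions `ω`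
of `A` and `B` on their subsets, in the dimension `2h` of the 2-sum `M`. Say that `s γ` holds if `γ`
spans `e`, and `t δ` if `δ` spans `f`. Both are up-sets. A set `γ ⊔ δ` has one more unit of corank
in `M` than `γ` and `δ` have together exactly when `s γ` and `t δ` hold (`corank_twoSum`). Since `u
X + v Y = h`, the weight of `γ ⊔ δ` in `M` is `u γ + v δ`, corrected by `-(u X + v Y)` where `s` and
`t` both hold.

Sums over orderings satisfy a linear recursion: the weight of a set times its chain sum is the sum
of the chain sums with one element removed. For an additive weight on a product of two Boolean
lattices the solution is a product, and this covers the region where `s` or `t` fails. On the region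
where both hold, pair the recursion with the dual solutions `W` and `Z` for the weights `u - u X`
and `v - v Y`, which count chains from above. All weights cancel except at the top, so a discrete
Green identity (`green`) reduces the top value to boundary terms, where the factorization is known.
The result (`sum_eq_cutSum_mul_cutSum`) is `(1 / v Y + 1 / u X)` times one factor, `cutSum`, from
each side.

Applied to `M`, this gives `(1 / a_e + 1 / b_f) * cut A * cut B`, because `a_e = v Y` and `b_f = u
X`. Applied to `A` alone, with `e` as a one-point second lattice whose factor is `1`, it gives `(1 /
a_e + 1 / b_f) * cut A`, and likewise for `B`. As `a_e + b_f = h`, the prefactor is `h / (a_e *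
b_f)`, while `h - a_e = b_f` and `h - b_f = a_e`; the position-space normalization makes the powers
of `h`, `a_e` and `b_f` match.

The series and parallel reductions are the case of a three-element uniform `B`, whose cut factor has
two terms. Denominators do not vanish because no nonempty proper subset sum of the indeterminates is
an integer multiple of `h`. -/

namespace HeppBound

/-! ### Chain sums, cut sums and the discrete Green identity -/

/-- The sum over all orderings of `γ` of the product of the inverses of `ω` over the non-empty
initial segments, defined by removing the last element. -/
noncomputable def chainSum {α K : Type*} [DecidableEq α] [Field K] (ω : Finset α → K)
    (γ : Finset α) : K :=
  if γ = ∅ then 1 else (ω γ)⁻¹ * ∑ x ∈ γ.attach, chainSum ω (γ.erase x.1)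
termination_by γ.card
decreasing_by exact Finset.card_erase_lt_of_mem x.2

section ChainSum

variable {α K : Type*} [DecidableEq α] [Field K]

theorem chainSum_empty (ω : Finset α → K) : chainSum ω ∅ = 1 := by
  rw [chainSum, if_pos rfl]

theorem chainSum_of_nonempty (ω : Finset α → K) {γ : Finset α} (hγ : γ.Nonempty) :
    chainSum ω γ = (ω γ)⁻¹ * ∑ x ∈ γ, chainSum ω (γ.erase x) := by
  rw [chainSum, if_neg hγ.ne_empty, Finset.sum_attach γ (fun x => chainSum ω (γ.erase x))]

theorem mul_chainSum {ω : Finset α → K} {γ : Finset α} (h0 : ω ∅ = 0)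
    (h : γ.Nonempty → ω γ ≠ 0) :
    ω γ * chainSum ω γ = ∑ x ∈ γ, chainSum ω (γ.erase x) := by
  rcases γ.eq_empty_or_nonempty with rfl | hγ
  · simp [h0]
  · rw [chainSum_of_nonempty ω hγ, mul_inv_cancel_left₀ (h hγ)]

theorem chainSum_singleton (ω : Finset α → K) (x : α) : chainSum ω {x} = (ω {x})⁻¹ := by
  rw [chainSum_of_nonempty ω (Finset.singleton_nonempty x)]
  simp [chainSum_empty]

/-- The sum over the maximal chains from `γ` to `X`, the counterpart of `chainSum` for which
elements are added. -/
noncomputable def cochainSum (ω : Finset α → K) (X γ : Finset α) : K :=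
  chainSum (fun δ => ω (X \ δ)) (X \ γ)

theorem cochainSum_self (ω : Finset α → K) (X : Finset α) : cochainSum ω X X = 1 := by
  rw [cochainSum, Finset.sdiff_self, chainSum_empty]

/-- The product runs over the sets from `γ` upwards with `X` left out. At `γ = X` both sides vanish:
the left because `ω X = 0`, the right as an empty sum. This lets the recursion hold without
exception at the top. -/
theorem mul_cochainSum {ω : Finset α → K} {X γ : Finset α} (hγ : γ ⊆ X) (h0 : ω X = 0)
    (h : γ ≠ X → ω γ ≠ 0) :
    ω γ * cochainSum ω X γ = ∑ x ∈ X \ γ, cochainSum ω X (insert x γ) := by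
  have h1 := mul_chainSum (ω := fun δ => ω (X \ δ)) (γ := X \ γ) (by simpa using h0) ?_
  · simp only [Finset.sdiff_sdiff_eq_self hγ] at h1
    rw [cochainSum, h1]
    refine Finset.sum_congr rfl fun x _ => ?_
    rw [cochainSum, Finset.sdiff_insert]
  · intro hne
    simp only [Finset.sdiff_sdiff_eq_self hγ]
    refine h fun heq => ?_
    subst heq
    simp at hne

theorem sum_powerset_erase (X : Finset α) (f : Finset α → Finset α → K) :
    ∑ γ ∈ X.powerset, ∑ x ∈ γ, f (γ.erase x) γ =
      ∑ γ ∈ X.powerset, ∑ x ∈ X \ γ, f γ (insert x γ) := by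
  rw [Finset.sum_sigma', Finset.sum_sigma']
  refine Finset.sum_bij' (fun p _ => ⟨p.1.erase p.2, p.2⟩) (fun p _ => ⟨insert p.2 p.1, p.2⟩)
    ?_ ?_ ?_ ?_ ?_
  · rintro ⟨γ, x⟩ h
    simp only [Finset.mem_sigma, Finset.mem_powerset, Finset.mem_sdiff] at h ⊢
    exact ⟨(Finset.erase_subset _ _).trans h.1, h.1 h.2, Finset.notMem_erase _ _⟩
  · rintro ⟨γ, x⟩ h
    simp only [Finset.mem_sigma, Finset.mem_powerset, Finset.mem_sdiff] at h ⊢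
    exact ⟨Finset.insert_subset h.2.1 h.1, Finset.mem_insert_self _ _⟩
  · rintro ⟨γ, x⟩ h
    simp only [Finset.mem_sigma] at h
    simp [Finset.insert_erase h.2]
  · rintro ⟨γ, x⟩ h
    simp only [Finset.mem_sigma, Finset.mem_sdiff] at h
    simp [Finset.erase_insert h.2.2]
  · rintro ⟨γ, x⟩ h
    simp only [Finset.mem_sigma] at h
    simp [Finset.insert_erase h.2]

open Classical in
/-- The sum of `F γ * G (γ ∪ x)` over the pairs for which `s` fails at `γ` and holds at
`γ ∪ x`. -/
noncomputable def boundarySum (s : Finset α → Prop) (X : Finset α) (F G : Finset α → K) : K :=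
  ∑ γ ∈ X.powerset, ∑ x ∈ X \ γ, if ¬ s γ ∧ s (insert x γ) then F γ * G (insert x γ) else 0

open Classical in
/-- Discrete Green identity on the up-set `s`. -/
theorem green {s : Finset α → Prop} {X : Finset α} (F G : Finset α → K)
    (hs : ∀ γ ⊆ X, ∀ x ∈ X, s γ → s (insert x γ)) :
    ∑ γ ∈ X.powerset, (if s γ then G γ * ∑ x ∈ γ, F (γ.erase x) -
      F γ * ∑ x ∈ X \ γ, G (insert x γ) else 0) = boundarySum s X F G := by
  -- The indicator is attached to the larger set of each pair. After reindexing, the two double sums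
  -- differ exactly on the pairs that enter `s`.
  have h1 := sum_powerset_erase X (fun γ δ => if s δ then F γ * G δ else 0)
  have h2 : ∀ γ : Finset α, (if s γ then G γ * ∑ x ∈ γ, F (γ.erase x) -
      F γ * ∑ x ∈ X \ γ, G (insert x γ) else 0) =
      ∑ x ∈ γ, (if s γ then F (γ.erase x) * G γ else 0) -
      ∑ x ∈ X \ γ, (if s γ then F γ * G (insert x γ) else 0) := by
    intro γ
    by_cases h : s γ
    · simp only [if_pos h, Finset.mul_sum, mul_comm]
    · simp [h]
  rw [Finset.sum_congr rfl fun γ _ => h2 γ, Finset.sum_sub_distrib, h1, ← Finset.sum_sub_distrib,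
    boundarySum]
  refine Finset.sum_congr rfl fun γ hγ => ?_
  rw [← Finset.sum_sub_distrib]
  refine Finset.sum_congr rfl fun x hx => ?_
  have h3 := hs γ (Finset.mem_powerset.1 hγ) x (Finset.mem_sdiff.1 hx).1
  by_cases h4 : s γ
  · simp [h4, h3 h4]
  · simp [h4]

/-- A set function `u` with an up-set `s`, such that the denominators needed below do not
vanish. -/
structure Cut (X : Finset α) (u : Finset α → K) (s : Finset α → Prop) : Prop where
  mono : ∀ γ ⊆ X, ∀ x ∈ X, s γ → s (insert x γ)
  not_empty : ¬ s ∅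
  top : s X
  zero : u ∅ = 0
  ne_zero : ∀ γ ⊆ X, γ.Nonempty → u γ ≠ 0
  ne_top : ∀ γ ⊆ X, s γ → γ ≠ X → u γ - u X ≠ 0

/-- The sum over all orderings of `X`, where `u` is replaced by `u - u X` on `s`. -/
noncomputable def cutSum (X : Finset α) (u : Finset α → K) (s : Finset α → Prop) : K :=
  boundarySum s X (chainSum u) (cochainSum (fun γ => u γ - u X) X)

theorem Cut.top_ne_zero {X : Finset α} {u : Finset α → K} {s : Finset α → Prop}
    (h : Cut X u s) : u X ≠ 0 := by
  refine h.ne_zero X subset_rfl ?_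
  rw [Finset.nonempty_iff_ne_empty]
  rintro rfl
  exact h.not_empty h.top

theorem Cut.mul_chainSum {X : Finset α} {u : Finset α → K} {s : Finset α → Prop}
    (h : Cut X u s) {γ : Finset α} (hγ : γ ⊆ X) :
    u γ * chainSum u γ = ∑ x ∈ γ, chainSum u (γ.erase x) :=
  HeppBound.mul_chainSum h.zero (h.ne_zero γ hγ)

theorem Cut.mul_cochainSum {X : Finset α} {u : Finset α → K} {s : Finset α → Prop}
    (h : Cut X u s) {γ : Finset α} (hγ : γ ⊆ X) (hsγ : s γ) :
    (u γ - u X) * cochainSum (fun γ => u γ - u X) X γ =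
      ∑ x ∈ X \ γ, cochainSum (fun γ => u γ - u X) X (insert x γ) :=
  HeppBound.mul_cochainSum (ω := fun γ => u γ - u X) hγ (sub_self _) (h.ne_top γ hγ hsγ)

-- Green's identity for `chainSum u` and its dual: their weights on `s` are `u γ` and `u γ - u X`,
-- so each summand is multiplied by the constant difference `u X`.
open Classical in
theorem Cut.sum_eq {X : Finset α} {u : Finset α → K} {s : Finset α → Prop} (h : Cut X u s) :
    ∑ γ ∈ X.powerset, (if s γ then
      chainSum u γ * cochainSum (fun γ => u γ - u X) X γ else 0) = (u X)⁻¹ * cutSum X u s := by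
  rw [eq_inv_mul_iff_mul_eq₀ h.top_ne_zero, cutSum, ← green _ _ h.mono, Finset.mul_sum]
  refine Finset.sum_congr rfl fun γ hγ => ?_
  rw [Finset.mem_powerset] at hγ
  split_ifs with hs
  · rw [← h.mul_chainSum hγ, ← h.mul_cochainSum hγ hs]
    ring
  · rw [mul_zero]

end ChainSum

/-! ### Factorization on a product of two Boolean lattices -/

section Product

variable {α β K : Type*} [DecidableEq α] [DecidableEq β] [Field K]

/-- Removing elements cannot lead into an up-set, so where `s` or `t` fails the recursion never
meets the correction. There the product of the chain sums solves the same recursion with the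
additive weight `u + v`. -/
theorem eq_mul_chainSum {X : Finset α} {Y : Finset β} {u : Finset α → K} {v : Finset β → K}
    {s : Finset α → Prop} {t : Finset β → Prop} (hu : Cut X u s) (hv : Cut Y v t)
    {R : Finset α → Finset β → K} (h0 : R ∅ ∅ = 1)
    (hne : ∀ γ ⊆ X, ∀ δ ⊆ Y, ¬ (s γ ∧ t δ) → (γ.Nonempty ∨ δ.Nonempty) → u γ + v δ ≠ 0)
    (hR : ∀ γ ⊆ X, ∀ δ ⊆ Y, (γ.Nonempty ∨ δ.Nonempty) → ¬ (s γ ∧ t δ) →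
      (u γ + v δ) * R γ δ = ∑ x ∈ γ, R (γ.erase x) δ + ∑ y ∈ δ, R γ (δ.erase y))
    {γ : Finset α} {δ : Finset β} (hγ : γ ⊆ X) (hδ : δ ⊆ Y) (hst : ¬ (s γ ∧ t δ)) :
    R γ δ = chainSum u γ * chainSum v δ := by
  induction hn : γ.card + δ.card using Nat.strong_induction_on generalizing γ δ with
  | _ n ih =>
    by_cases hz : γ.Nonempty ∨ δ.Nonempty
    · refine mul_left_cancel₀ (hne γ hγ δ hδ hst hz) ?_
      rw [hR γ hγ δ hδ hz hst]
      have h1 : ∀ x ∈ γ, R (γ.erase x) δ = chainSum u (γ.erase x) * chainSum v δ := by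
        intro x hx
        have := Finset.card_erase_lt_of_mem hx
        have hsub := (Finset.erase_subset x γ).trans hγ
        refine ih _ (by omega) hsub hδ (fun hc => hst ⟨?_, hc.2⟩) rfl
        have := hu.mono _ hsub x (hγ hx) hc.1
        rwa [Finset.insert_erase hx] at this
      have h2 : ∀ y ∈ δ, R γ (δ.erase y) = chainSum u γ * chainSum v (δ.erase y) := by
        intro y hy
        have := Finset.card_erase_lt_of_mem hy
        have hsub := (Finset.erase_subset y δ).trans hδ
        refine ih _ (by omega) hγ hsub (fun hc => hst ⟨hc.1, ?_⟩) rfl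
        have := hv.mono _ hsub y (hδ hy) hc.2
        rwa [Finset.insert_erase hy] at this
      rw [Finset.sum_congr rfl h1, Finset.sum_congr rfl h2, ← Finset.sum_mul, ← Finset.mul_sum,
        ← hu.mul_chainSum hγ, ← hv.mul_chainSum hδ]
      ring
    · simp only [not_or, Finset.not_nonempty_iff_eq_empty] at hz
      rw [hz.1, hz.2, h0, chainSum_empty, chainSum_empty, one_mul]

open Classical in
/-- A solution `R` of the recursion of `chainSum` on the product of two Boolean lattices, for the
weight `u + v` with the correction `u X + v Y` where both `s` and `t` hold, factorizes. -/
theorem sum_eq_cutSum_mul_cutSum {X : Finset α} {Y : Finset β} {u : Finset α → K}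
    {v : Finset β → K} {s : Finset α → Prop} {t : Finset β → Prop} (hu : Cut X u s)
    (hv : Cut Y v t) {R : Finset α → Finset β → K} (h0 : R ∅ ∅ = 1)
    (hne : ∀ γ ⊆ X, ∀ δ ⊆ Y, ¬ (s γ ∧ t δ) → (γ.Nonempty ∨ δ.Nonempty) → u γ + v δ ≠ 0)
    (hR : ∀ γ ⊆ X, ∀ δ ⊆ Y, (γ.Nonempty ∨ δ.Nonempty) → (γ ≠ X ∨ δ ≠ Y) →
      (u γ + v δ - if s γ ∧ t δ then u X + v Y else 0) * R γ δ =
        ∑ x ∈ γ, R (γ.erase x) δ + ∑ y ∈ δ, R γ (δ.erase y)) :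
    ∑ x ∈ X, R (X.erase x) Y + ∑ y ∈ Y, R X (Y.erase y) =
      ((v Y)⁻¹ + (u X)⁻¹) * (cutSum X u s * cutSum Y v t) := by
  set W := cochainSum (fun γ => u γ - u X) X with hW
  set Z := cochainSum (fun δ => v δ - v Y) Y with hZ
  have hRP : ∀ {γ : Finset α} {δ : Finset β}, γ ⊆ X → δ ⊆ Y → ¬ (s γ ∧ t δ) →
      R γ δ = chainSum u γ * chainSum v δ := by
    intro γ δ hγ hδ hst
    refine eq_mul_chainSum hu hv h0 hne ?_ hγ hδ hst
    intro γ hγ δ hδ hz hst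
    have := hR γ hγ δ hδ hz ?_
    · rwa [if_neg hst, sub_zero] at this
    · by_contra hc
      simp only [not_or, not_not] at hc
      exact hst ⟨hc.1 ▸ hu.top, hc.2 ▸ hv.top⟩
  have hx : ∀ δ ⊆ Y, t δ → ∑ γ ∈ X.powerset, (if s γ then W γ * ∑ x ∈ γ, R (γ.erase x) δ -
      R γ δ * ∑ x ∈ X \ γ, W (insert x γ) else 0) = cutSum X u s * chainSum v δ := by
    intro δ hδ htδ
    rw [green (fun γ => R γ δ) W hu.mono, cutSum, boundarySum, boundarySum, Finset.sum_mul]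
    refine Finset.sum_congr rfl fun γ hγ => ?_
    rw [Finset.sum_mul]
    refine Finset.sum_congr rfl fun x _ => ?_
    split_ifs with h
    · rw [hRP (Finset.mem_powerset.1 hγ) hδ fun hc => h.1 hc.1]
      ring
    · rw [zero_mul]
  have hy : ∀ γ ⊆ X, s γ → ∑ δ ∈ Y.powerset, (if t δ then Z δ * ∑ y ∈ δ, R γ (δ.erase y) -
      R γ δ * ∑ y ∈ Y \ δ, Z (insert y δ) else 0) = cutSum Y v t * chainSum u γ := by
    intro γ hγ hsγ
    rw [green (fun δ => R γ δ) Z hv.mono, cutSum, boundarySum, boundarySum, Finset.sum_mul]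
    refine Finset.sum_congr rfl fun δ hδ => ?_
    rw [Finset.sum_mul]
    refine Finset.sum_congr rfl fun y _ => ?_
    split_ifs with h
    · rw [hRP hγ (Finset.mem_powerset.1 hδ) fun hc => h.1 hc.2]
      ring
    · rw [zero_mul]
  -- Summed over the region where `s` and `t` hold, the combination vanishes term by term below the
  -- top, since `(u γ + v δ - u X - v Y) - (u γ - u X) - (v δ - v Y) = 0`. At the top `W = Z = 1`
  -- and the dual sums are empty, so only the removals from `R` remain; no recursion for `R X Y` is
  -- needed.
  have key : ∑ γ ∈ X.powerset, ∑ δ ∈ Y.powerset,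
      ((if t δ then Z δ * (if s γ then W γ * ∑ x ∈ γ, R (γ.erase x) δ -
        R γ δ * ∑ x ∈ X \ γ, W (insert x γ) else 0) else 0) +
      (if s γ then W γ * (if t δ then Z δ * ∑ y ∈ δ, R γ (δ.erase y) -
        R γ δ * ∑ y ∈ Y \ δ, Z (insert y δ) else 0) else 0)) =
      ∑ x ∈ X, R (X.erase x) Y + ∑ y ∈ Y, R X (Y.erase y) := by
    rw [Finset.sum_eq_single X, Finset.sum_eq_single Y]
    · simp [hu.top, hv.top, hW, hZ, cochainSum_self]
    · intro δ hδ hne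
      rw [Finset.mem_powerset] at hδ
      by_cases ht : t δ
      · have h1 := hR X subset_rfl δ hδ (Or.inl ?_) (Or.inr hne)
        · rw [if_pos ⟨hu.top, ht⟩] at h1
          rw [if_pos ht, if_pos hu.top, if_pos hu.top, if_pos ht, ← hu.mul_cochainSum subset_rfl
            hu.top, ← hv.mul_cochainSum hδ ht]
          linear_combination (-(W X * Z δ)) * h1
        · rw [Finset.nonempty_iff_ne_empty]
          rintro rfl
          exact hu.not_empty hu.top
      · simp [ht]
    · simp
    · intro γ hγ hne
      refine Finset.sum_eq_zero fun δ hδ => ?_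
      rw [Finset.mem_powerset] at hδ hγ
      by_cases hst : s γ ∧ t δ
      · have h1 := hR γ hγ δ hδ (Or.inl ?_) (Or.inl hne)
        · rw [if_pos hst] at h1
          rw [if_pos hst.1, if_pos hst.2, if_pos hst.1, if_pos hst.2,
            ← hu.mul_cochainSum hγ hst.1, ← hv.mul_cochainSum hδ hst.2]
          linear_combination (-(W γ * Z δ)) * h1
        · rw [Finset.nonempty_iff_ne_empty]
          rintro rfl
          exact hu.not_empty hst.1
      · by_cases h1 : s γ
        · have h2 : ¬ t δ := fun h2 => hst ⟨h1, h2⟩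
          simp [h2]
        · simp [h1]
    · simp
  rw [← key]
  simp only [Finset.sum_add_distrib]
  -- The first half is summed over `γ` inside, with `δ` fixed, and the second the other way round.
  -- Each inner sum is then a Green sum (`hx`, `hy`), and the outer one is evaluated by
  -- `Cut.sum_eq`.
  rw [Finset.sum_comm, add_mul]
  congr 1
  · trans ∑ δ ∈ Y.powerset, cutSum X u s * (if t δ then chainSum v δ * Z δ else 0)
    · refine Finset.sum_congr rfl fun δ hδ => ?_
      split_ifs with ht
      · rw [← Finset.mul_sum, hx δ (Finset.mem_powerset.1 hδ) ht]
        ring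
      · simp
    · rw [← Finset.mul_sum, hv.sum_eq]
      ring
  · trans ∑ γ ∈ X.powerset, cutSum Y v t * (if s γ then chainSum u γ * W γ else 0)
    · refine Finset.sum_congr rfl fun γ hγ => ?_
      split_ifs with hs
      · rw [← Finset.mul_sum, hy γ (Finset.mem_powerset.1 hγ) hs]
        ring
      · simp
    · rw [← Finset.mul_sum, hu.sum_eq]
      ring

end Product

end HeppBound

namespace HeppBound

/-! ### The Hepp bound as a sum of chain sums -/

section Orders

variable {α K : Type*} [DecidableEq α] [Field K]

/-- Extend an order of `γ ∖ x` by `x` as the last element. -/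
noncomputable def snocOrder {γ : Finset α} {n : ℕ} (hn : γ.card = n + 1) {x : α} (hx : x ∈ γ)
    (τ : Fin n ≃ ((γ.erase x : Finset α) : Set α)) : Fin (n + 1) ≃ (γ : Set α) :=
  Equiv.ofBijective
    (Fin.snoc (α := fun _ => (γ : Set α))
      (fun i => ⟨(τ i : α), Finset.mem_of_mem_erase (τ i).2⟩) ⟨x, hx⟩) <| by
    rw [Fintype.bijective_iff_injective_and_card]
    constructor
    · rw [Fin.snoc_injective_iff]
      constructor
      · intro i j hij
        simpa [Subtype.ext_iff] using hij
      · rintro ⟨i, hi⟩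
        have h1 := (τ i).2
        rw [Subtype.ext_iff] at hi
        simp only at hi
        rw [hi] at h1
        simp at h1
    · simp [hn]

theorem snocOrder_castSucc {γ : Finset α} {n : ℕ} (hn : γ.card = n + 1) {x : α} (hx : x ∈ γ)
    (τ : Fin n ≃ ((γ.erase x : Finset α) : Set α)) (i : Fin n) :
    (snocOrder hn hx τ i.castSucc : α) = τ i := by
  simp [snocOrder]

theorem snocOrder_last {γ : Finset α} {n : ℕ} (hn : γ.card = n + 1) {x : α} (hx : x ∈ γ)
    (τ : Fin n ≃ ((γ.erase x : Finset α) : Set α)) :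
    (snocOrder hn hx τ (Fin.last n) : α) = x := by
  simp [snocOrder]

theorem initialSet_snocOrder {γ : Finset α} {n : ℕ} (hn : γ.card = n + 1) {x : α} (hx : x ∈ γ)
    (τ : Fin n ≃ ((γ.erase x : Finset α) : Set α)) {k : ℕ} (hk : k ≤ n) :
    initialSet (snocOrder hn hx τ) k = initialSet τ k := by
  ext y
  constructor
  · rintro ⟨i, hi, rfl⟩
    refine ⟨⟨i, by omega⟩, hi, ?_⟩
    rw [← snocOrder_castSucc hn hx]
    rfl
  · rintro ⟨i, hi, rfl⟩
    exact ⟨i.castSucc, hi, snocOrder_castSucc hn hx τ i⟩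

theorem initialSet_eq {α : Type*} {γ : Finset α} {n : ℕ} (σ : Fin n ≃ (γ : Set α)) :
    initialSet σ n = γ := by
  ext y
  constructor
  · rintro ⟨i, -, rfl⟩
    exact (σ i).2
  · intro hy
    exact ⟨σ.symm ⟨y, hy⟩, (σ.symm ⟨y, hy⟩).2, by simp⟩

/-- The index `k` stops at `n`, so the full set contributes no factor and the product depends only
on the order of the elements before the last one. -/
theorem sum_orders_eq_sum_last (ω : Set α → K) {γ : Finset α} {n : ℕ} (hn : γ.card = n + 1) :
    ∑ σ : Fin (n + 1) ≃ (γ : Set α), ∏ k ∈ Finset.Ico 1 (n + 1), (ω (initialSet σ k))⁻¹ =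
      ∑ x ∈ γ, ∑ τ : Fin n ≃ ((γ.erase x : Finset α) : Set α),
        ∏ k ∈ Finset.Ico 1 (n + 1), (ω (initialSet τ k))⁻¹ := by
  classical
  rw [← Finset.sum_fiberwise_of_maps_to (s := Finset.univ) (t := γ)
    (g := fun σ : Fin (n + 1) ≃ (γ : Set α) => (σ (Fin.last n) : α)) fun σ _ =>
      (σ (Fin.last n)).2]
  refine Finset.sum_congr rfl fun x hx => ?_
  symm
  refine Finset.sum_bij (fun τ _ => snocOrder hn hx τ) ?_ ?_ ?_ ?_
  · intro τ _
    rw [Finset.mem_filter]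
    exact ⟨Finset.mem_univ _, snocOrder_last hn hx τ⟩
  · intro τ _ τ' _ h
    ext i
    rw [← snocOrder_castSucc hn hx, h, snocOrder_castSucc]
  · intro σ hσ
    simp only [Finset.mem_filter, Finset.mem_univ, true_and] at hσ
    have hinj : Function.Injective (fun i : Fin n =>
        (⟨(σ i.castSucc : α), Finset.mem_erase.2 ⟨fun h => by
          rw [← hσ, ← Subtype.ext_iff, σ.injective.eq_iff] at h
          exact (Fin.castSucc_lt_last i).ne h, (σ i.castSucc).2⟩⟩ :
          ((γ.erase x : Finset α) : Set α))) := by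
      intro i j hij
      simpa [Subtype.ext_iff, ← Subtype.ext_iff, σ.injective.eq_iff] using hij
    refine ⟨Equiv.ofBijective _ ((Fintype.bijective_iff_injective_and_card _).2 ⟨hinj, ?_⟩),
      Finset.mem_univ _, ?_⟩
    · rw [Fintype.card_fin, ← Nat.card_eq_fintype_card, Nat.card_coe_set_eq, Set.ncard_coe_finset,
        Finset.card_erase_of_mem hx, hn, Nat.add_sub_cancel]
    · ext i
      refine Fin.lastCases ?_ (fun i => ?_) i
      · rw [snocOrder_last, hσ]
      · rw [snocOrder_castSucc]
        rfl
  · intro τ _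
    refine Finset.prod_congr rfl fun k hk => ?_
    rw [initialSet_snocOrder hn hx τ (by simp at hk; omega)]

theorem sum_orders_eq_chainSum (ω : Set α → K) {γ : Finset α} {n : ℕ} (hn : γ.card = n) :
    ∑ σ : Fin n ≃ (γ : Set α), ∏ k ∈ Finset.Ico 1 (n + 1), (ω (initialSet σ k))⁻¹ =
      chainSum (fun δ => ω δ) γ := by
  induction n generalizing γ with
  | zero =>
    rw [Finset.card_eq_zero] at hn
    subst hn
    have : IsEmpty ((∅ : Finset α) : Set α) := by simp
    have : Unique (Fin 0 ≃ ((∅ : Finset α) : Set α)) :=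
      { default := Equiv.equivOfIsEmpty _ _, uniq := fun e => by ext i; exact i.elim0 }
    simp [chainSum_empty]
  | succ n ih =>
    have hne : γ.Nonempty := Finset.card_pos.1 (by omega)
    rw [chainSum_of_nonempty _ hne]
    have h1 : ∀ σ : Fin (n + 1) ≃ (γ : Set α),
        ∏ k ∈ Finset.Ico 1 (n + 1 + 1), (ω (initialSet σ k))⁻¹ =
          (ω γ)⁻¹ * ∏ k ∈ Finset.Ico 1 (n + 1), (ω (initialSet σ k))⁻¹ := by
      intro σ
      rw [Finset.prod_Ico_succ_top (by omega), initialSet_eq, mul_comm]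
    rw [Finset.sum_congr rfl fun σ _ => h1 σ, ← Finset.mul_sum, sum_orders_eq_sum_last ω hn]
    congr 1
    refine Finset.sum_congr rfl fun x hx => ih ?_
    rw [Finset.card_erase_of_mem hx, hn, Nat.add_sub_cancel]

theorem hepp_eq_sum_chainSum {M : Matroid α} {a : α → K} {E : Finset α} (hE : M.E = E)
    (hne : E.Nonempty) :
    hepp M a = ∑ x ∈ E, chainSum (fun γ => sdc M (halfDim M a) a γ) (E.erase x) := by
  obtain ⟨n, hn⟩ : ∃ n, E.card = n + 1 := ⟨E.card - 1, by have := hne.card_pos; omega⟩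
  rw [hepp]
  generalize sdc M (halfDim M a) a = ω
  rw [hE, Set.ncard_coe_finset, hn, finsum_eq_sum_of_fintype, sum_orders_eq_sum_last ω hn]
  refine Finset.sum_congr rfl fun x hx => sum_orders_eq_chainSum ω ?_
  rw [Finset.card_erase_of_mem hx, hn, Nat.add_sub_cancel]

end Orders

end HeppBound

namespace HeppBound

open Set

/-! ### Corank and closure -/

section Corank

variable {α : Type*} {M : Matroid α} {γ I : Set α} {e : α}

theorem corank_add_ncard (hI : M.IsBasis I γ) (hγ : γ.Finite) :
    corank M γ + I.ncard = γ.ncard := by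
  have h1 : I.ncard ≤ γ.ncard := ncard_le_ncard hI.subset hγ
  have h2 : (M.eRk γ).toNat = I.ncard := by
    rw [hI.eRk_eq_encard, ncard_def]
  rw [corank, h2]
  omega

open Classical in
theorem corank_insert (hγ : γ.Finite) (hE : γ ⊆ M.E) (he : e ∈ M.E) (heγ : e ∉ γ) :
    corank M (insert e γ) = corank M γ + if e ∈ M.closure γ then 1 else 0 := by
  obtain ⟨I, hI⟩ := M.exists_isBasis γ
  have h1 := corank_add_ncard hI hγ
  have h2 := ncard_insert_of_notMem heγ hγ
  split_ifs with h
  · have hI' : M.IsBasis I (insert e γ) := by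
      rw [Matroid.isBasis_iff_indep_subset_closure]
      refine ⟨hI.indep, hI.subset.trans (subset_insert _ _), insert_subset ?_ hI.subset_closure⟩
      rwa [hI.closure_eq_closure]
    have h3 := corank_add_ncard hI' (hγ.insert e)
    omega
  · have hI' := hI.insert_isBasis_insert_of_notMem_closure (e := e)
      (by rwa [hI.closure_eq_closure])
    have h3 := corank_add_ncard hI' (hγ.insert e)
    rw [ncard_insert_of_notMem (fun hc => heγ (hI.subset hc)) (hγ.subset hI.subset)] at h3
    omega

theorem corank_empty : corank M ∅ = 0 := by
  simp [corank]

theorem corank_delete (hγ : Disjoint γ {e}) : corank (M.delete {e}) γ = corank M γ := by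
  rw [corank, corank, Matroid.delete_eq_restrict, Matroid.restrict_eRk_eq', ← M.eRk_inter_ground γ]
  congr 3
  ext x
  simp only [mem_inter_iff, mem_sdiff, mem_singleton_iff]
  refine ⟨fun h => ⟨h.1, h.2.1⟩, fun h => ⟨h.1, h.2, ?_⟩⟩
  rintro rfl
  exact disjoint_singleton_right.1 hγ h.1

end Corank

section TwoSummand

variable {α : Type*} {A : Matroid α} {e : α} {I : Set α}

theorem TwoSummand.notMem_closure_empty (hA : TwoSummand A e) : e ∉ A.closure ∅ := by
  rw [A.empty_indep.notMem_closure_iff_of_notMem (notMem_empty e) hA.mem]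
  simpa using hA.indep

theorem TwoSummand.mem_closure_diff (hA : TwoSummand A e) : e ∈ A.closure (A.E \ {e}) := by
  rw [hA.coindep.closure_compl]
  exact hA.mem

theorem exists_delete_isBase_superset (hI : A.Indep I) (he : e ∉ I) :
    ∃ S, I ⊆ S ∧ (A.delete {e}).IsBase S := by
  have h : (A.delete {e}).Indep I := by
    rw [Matroid.delete_indep_iff]
    exact ⟨hI, disjoint_singleton_right.2 he⟩
  obtain ⟨S, hS, hIS⟩ := h.exists_isBase_superset
  exact ⟨S, hIS, hS⟩

theorem TwoSummand.exists_contract_isBase (hA : TwoSummand A e) (hI : A.Indep I)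
    (he : e ∉ A.closure I) : ∃ S, I ⊆ S ∧ (A.contract {e}).IsBase S := by
  have heI : e ∉ I := fun h => he (A.mem_closure_of_mem h hI.subset_ground)
  rw [hI.notMem_closure_iff_of_notMem heI hA.mem] at he
  obtain ⟨S, hS, hIS⟩ := he.exists_isBase_superset
  refine ⟨S \ {e}, fun x hx => ⟨hIS (mem_insert_of_mem _ hx), fun h => heI (h ▸ hx)⟩, ?_⟩
  rw [hA.indep.contract_isBase_iff]
  refine ⟨?_, disjoint_sdiff_left⟩
  rwa [sdiff_union_of_subset (singleton_subset_iff.2 (hIS (mem_insert _ _)))]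

theorem TwoSummand.of_delete_isBase (hA : TwoSummand A e) {S : Set α}
    (hS : (A.delete {e}).IsBase S) : A.Indep S ∧ e ∉ S := by
  rw [hA.coindep.delete_isBase_iff] at hS
  exact ⟨hS.1.indep, disjoint_singleton_right.1 hS.2⟩

theorem TwoSummand.of_contract_isBase (hA : TwoSummand A e) {S : Set α}
    (hS : (A.contract {e}).IsBase S) : A.Indep S ∧ e ∉ S ∧ e ∉ A.closure S := by
  rw [hA.indep.contract_isBase_iff] at hS
  have h1 : A.Indep S := hS.1.indep.subset subset_union_left
  have h2 : e ∉ S := disjoint_singleton_right.1 hS.2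
  refine ⟨h1, h2, ?_⟩
  rw [h1.notMem_closure_iff_of_notMem h2 hA.mem, ← union_singleton]
  exact hS.1.indep

end TwoSummand

/-! ### Independent sets and coranks of the 2-sum -/

section TwoSum

variable {α β : Type*} {A : Matroid α} {B : Matroid β} {e : α} {f : β}

theorem preimage_inl_sum (S : Set α) (T : Set β) :
    (Sum.inl ⁻¹' (Sum.inl '' S ∪ Sum.inr '' T) : Set α) = S := by
  ext x; simp

theorem preimage_inr_sum (S : Set α) (T : Set β) :
    (Sum.inr ⁻¹' (Sum.inl '' S ∪ Sum.inr '' T) : Set β) = T := by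
  ext x; simp

theorem subset_sum {X : Set (α ⊕ β)} {S : Set α} {T : Set β} (h1 : Sum.inl ⁻¹' X ⊆ S)
    (h2 : Sum.inr ⁻¹' X ⊆ T) : X ⊆ Sum.inl '' S ∪ Sum.inr '' T := by
  rintro (x | y) hx
  · exact Or.inl ⟨x, h1 hx, rfl⟩
  · exact Or.inr ⟨y, h2 hx, rfl⟩

/-- A base of `A / e` is an independent set that extends by `e`, hence does not span `e`; a base of
`A ∖ e` carries no such restriction. At least one side of a base of the 2-sum is of the first kind,
and any pair of independent sets not spanning both marked elements extends to such a base. -/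
theorem twoSum_indep_iff (hA : TwoSummand A e) (hB : TwoSummand B f) {X : Set (α ⊕ β)} :
    (twoSum hA hB).Indep X ↔ Sum.inl e ∉ X ∧ Sum.inr f ∉ X ∧ A.Indep (Sum.inl ⁻¹' X) ∧
      B.Indep (Sum.inr ⁻¹' X) ∧
      ¬ (e ∈ A.closure (Sum.inl ⁻¹' X) ∧ f ∈ B.closure (Sum.inr ⁻¹' X)) := by
  rw [Matroid.indep_iff]
  constructor
  · rintro ⟨T, hT, hXT⟩
    replace hT : TwoSumIsBase A B e f T := hT
    have hl : Sum.inl ⁻¹' X ⊆ (Sum.inl ⁻¹' T : Set α) := preimage_mono hXT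
    have hr : Sum.inr ⁻¹' X ⊆ (Sum.inr ⁻¹' T : Set β) := preimage_mono hXT
    rcases hT with ⟨h1, h2⟩ | ⟨h1, h2⟩
    · obtain ⟨h3, h4⟩ := hA.of_delete_isBase h1
      obtain ⟨h5, h6, h7⟩ := hB.of_contract_isBase h2
      exact ⟨fun h => h4 (hl h), fun h => h6 (hr h), h3.subset hl, h5.subset hr,
        fun h => h7 (B.closure_subset_closure hr h.2)⟩
    · obtain ⟨h3, h4⟩ := hB.of_delete_isBase h2
      obtain ⟨h5, h6, h7⟩ := hA.of_contract_isBase h1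
      exact ⟨fun h => h6 (hl h), fun h => h4 (hr h), h5.subset hl, h3.subset hr,
        fun h => h7 (A.closure_subset_closure hl h.1)⟩
  · rintro ⟨h1, h2, h3, h4, h5⟩
    by_cases h : e ∈ A.closure (Sum.inl ⁻¹' X)
    · obtain ⟨S, hS, hS'⟩ := exists_delete_isBase_superset h3 h1
      obtain ⟨T, hT, hT'⟩ := hB.exists_contract_isBase h4 fun h' => h5 ⟨h, h'⟩
      refine ⟨Sum.inl '' S ∪ Sum.inr '' T, Or.inl ?_, subset_sum hS hT⟩
      rw [preimage_inl_sum, preimage_inr_sum]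
      exact ⟨hS', hT'⟩
    · obtain ⟨S, hS, hS'⟩ := hA.exists_contract_isBase h3 h
      obtain ⟨T, hT, hT'⟩ := exists_delete_isBase_superset h4 h2
      refine ⟨Sum.inl '' S ∪ Sum.inr '' T, Or.inr ?_, subset_sum hS hT⟩
      rw [preimage_inl_sum, preimage_inr_sum]
      exact ⟨hS', hT'⟩

theorem sum_insert_inl (x : α) (S : Set α) (T : Set β) :
    insert (Sum.inl x) (Sum.inl '' S ∪ Sum.inr '' T) = Sum.inl '' (insert x S) ∪ Sum.inr '' T := by
  rw [image_insert_eq, insert_union]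

theorem sum_insert_inr (y : β) (S : Set α) (T : Set β) :
    insert (Sum.inr y) (Sum.inl '' S ∪ Sum.inr '' T) = Sum.inl '' S ∪ Sum.inr '' (insert y T) := by
  rw [image_insert_eq, union_insert]

theorem ncard_sum {S : Set α} {T : Set β} (hS : S.Finite) (hT : T.Finite) :
    (Sum.inl '' S ∪ Sum.inr '' T : Set (α ⊕ β)).ncard = S.ncard + T.ncard := by
  rw [ncard_union_eq ?_ (hS.image _) (hT.image _), ncard_image_of_injective _ Sum.inl_injective,
    ncard_image_of_injective _ Sum.inr_injective]
  rw [disjoint_left]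
  rintro _ ⟨x, -, rfl⟩ ⟨y, -, h⟩
  cases h

/-- Maximality need only be tested on extensions that stay independent on their own side; these must
fail by making both sides span the marked elements. -/
theorem twoSum_isBasis (hA : TwoSummand A e) (hB : TwoSummand B f) {γ I : Set α} {δ J : Set β}
    (hγ : γ ⊆ A.E \ {e}) (hδ : δ ⊆ B.E \ {f}) (hI : A.Indep I) (hJ : B.Indep J) (hIγ : I ⊆ γ)
    (hJδ : J ⊆ δ) (hIJ : ¬ (e ∈ A.closure I ∧ f ∈ B.closure J))
    (h1 : ∀ x ∈ γ \ I, A.Indep (insert x I) →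
      e ∈ A.closure (insert x I) ∧ f ∈ B.closure J)
    (h2 : ∀ y ∈ δ \ J, B.Indep (insert y J) →
      e ∈ A.closure I ∧ f ∈ B.closure (insert y J)) :
    (twoSum hA hB).IsBasis (Sum.inl '' I ∪ Sum.inr '' J) (Sum.inl '' γ ∪ Sum.inr '' δ) := by
  have hE : Sum.inl '' γ ∪ Sum.inr '' δ ⊆ (twoSum hA hB).E :=
    union_subset_union (image_mono hγ) (image_mono hδ)
  have hsub : Sum.inl '' I ∪ Sum.inr '' J ⊆ (Sum.inl '' γ ∪ Sum.inr '' δ : Set (α ⊕ β)) :=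
    union_subset_union (image_mono hIγ) (image_mono hJδ)
  refine Matroid.Indep.isBasis_of_forall_insert ?_ hsub ?_
  · rw [twoSum_indep_iff, preimage_inl_sum, preimage_inr_sum]
    refine ⟨?_, ?_, hI, hJ, hIJ⟩
    · intro h
      exact (hE (hsub h)).elim (by simp) (by simp)
    · intro h
      exact (hE (hsub h)).elim (by simp) (by simp)
  · intro z hz
    refine ⟨fun hc => ?_, insert_subset (hE hz.1) (hsub.trans hE)⟩
    obtain ⟨⟨x, hx, rfl⟩ | ⟨y, hy, rfl⟩, hz⟩ := hz
    · rw [sum_insert_inl, twoSum_indep_iff, preimage_inl_sum, preimage_inr_sum] at hc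
      exact hc.2.2.2.2 (h1 x ⟨hx, fun h => hz (Or.inl ⟨x, h, rfl⟩)⟩ hc.2.2.1)
    · rw [sum_insert_inr, twoSum_indep_iff, preimage_inl_sum, preimage_inr_sum] at hc
      exact hc.2.2.2.2 (h2 y ⟨hy, fun h => hz (Or.inr ⟨y, h, rfl⟩)⟩ hc.2.2.2.1)

open Classical in
theorem corank_twoSum (hA : TwoSummand A e) (hB : TwoSummand B f) {γ : Set α} {δ : Set β}
    (hγ : γ ⊆ A.E \ {e}) (hδ : δ ⊆ B.E \ {f}) :
    corank (twoSum hA hB) (Sum.inl '' γ ∪ Sum.inr '' δ) =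
      corank A γ + corank B δ + if e ∈ A.closure γ ∧ f ∈ B.closure δ then 1 else 0 := by
  have hγE : γ ⊆ A.E := hγ.trans sdiff_subset
  have hδE : δ ⊆ B.E := hδ.trans sdiff_subset
  have hγf : γ.Finite := hA.finite.ground_finite.subset hγE
  have hδf : δ.Finite := hB.finite.ground_finite.subset hδE
  obtain ⟨J, hJ⟩ := B.exists_isBasis δ
  have hcJ := corank_add_ncard hJ hδf
  have hJ2 : ∀ y ∈ δ \ J, ¬ B.Indep (insert y J) := fun y hy => (hJ.insert_dep hy).not_indep
  have hJf := hδf.subset hJ.subset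
  have hN := ncard_sum hγf hδf
  have hNf := (hγf.image (Sum.inl : α → α ⊕ β)).union (hδf.image (Sum.inr : β → α ⊕ β))
  split_ifs with h
  · have heγ : e ∉ γ := fun h => (hγ h).2 rfl
    -- A basis of `γ ∪ e` through `e` has as many elements as one of `γ`, because `γ` spans `e`.
    -- Removing `e` leaves an independent subset of `γ` that does not span `e` and is one element
    -- short; this is the extra unit of corank.
    obtain ⟨K, hK, heK⟩ := hA.indep.subset_isBasis_of_subset (X := insert e γ)
      (singleton_subset_iff.2 (mem_insert _ _)) (insert_subset hA.mem hγE)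
    rw [singleton_subset_iff] at heK
    have hc := corank_insert hγf hγE hA.mem heγ
    rw [if_pos h.1] at hc
    have hK1 := corank_add_ncard hK (hγf.insert e)
    rw [ncard_insert_of_notMem heγ hγf] at hK1
    have hKf : K.Finite := (hγf.insert e).subset hK.subset
    have hK2 := ncard_sdiff_singleton_add_one heK hKf
    have hI : A.Indep (K \ {e}) := hK.indep.subset sdiff_subset
    have heI : e ∉ A.closure (K \ {e}) := by
      rw [hI.notMem_closure_iff_of_notMem (fun h => h.2 rfl) hA.mem, insert_sdiff_singleton,
        insert_eq_of_mem heK]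
      exact hK.indep
    have hIγ : K \ {e} ⊆ γ := fun x hx => (hK.subset hx.1).resolve_left hx.2
    have hbas := twoSum_isBasis hA hB hγ hδ hI hJ.indep hIγ hJ.subset (fun h => heI h.1) ?_
      fun y hy hc => (hJ2 y hy hc).elim
    · have := corank_add_ncard hbas hNf
      rw [hN, ncard_sum (hγf.subset hIγ) hJf] at this
      omega
    · intro x hx hxI
      refine ⟨?_, by rw [hJ.closure_eq_closure]; exact h.2⟩
      -- If adding `x` did not make the set span `e`, then `K ∪ x` would be independent, contrary to
      -- the choice of `K`.
      by_contra hcon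
      have hex : e ≠ x := fun h => heγ (h ▸ hx.1)
      rw [hxI.notMem_closure_iff_of_notMem (fun hc => hc.elim hex fun hc => hc.2 rfl) hA.mem,
        insert_comm, insert_sdiff_singleton, insert_eq_of_mem heK] at hcon
      exact (hK.insert_dep ⟨mem_insert_of_mem _ hx.1, fun hc => hx.2 ⟨hc, hex.symm⟩⟩).not_indep
        hcon
  · obtain ⟨I, hI⟩ := A.exists_isBasis γ
    have hcI := corank_add_ncard hI hγf
    have hbas := twoSum_isBasis hA hB hγ hδ hI.indep hJ.indep hI.subset hJ.subset
      (by rwa [hI.closure_eq_closure, hJ.closure_eq_closure])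
      (fun x hx hc => ((hI.insert_dep hx).not_indep hc).elim)
      fun y hy hc => (hJ2 y hy hc).elim
    have := corank_add_ncard hbas hNf
    rw [hN, ncard_sum (hγf.subset hI.subset) hJf] at this
    omega

end TwoSum

end HeppBound

namespace HeppBound

/-! ### The Hepp bound of one summand -/

section Summand

variable {α K : Type*} [Field K]

theorem sdc_coe (M : Matroid α) (h : K) (a : α → K) (γ : Finset α) :
    sdc M h a γ = ∑ x ∈ γ, a x - h * (corank M γ : K) := by
  rw [sdc, finsum_mem_coe_finset]

/-- The only step crosses from the empty set to the top, and neither end carries a weight. The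
marked element of a single matroid thereby plays the role of the second lattice. -/
theorem cutSum_unit (v : Finset Unit → K) :
    cutSum Finset.univ v (fun δ => δ.Nonempty) = 1 := by
  classical
  rw [cutSum, boundarySum, show (Finset.univ : Finset Unit) = insert () ∅ from rfl,
    Finset.sum_powerset_insert (Finset.notMem_empty _)]
  have h : cochainSum (fun γ => v γ - v {()}) {()} {()} = 1 := cochainSum_self _ _
  simp [chainSum_empty, h]

theorem cut_unit {p : K} (hp : p ≠ 0) :
    Cut (Finset.univ : Finset Unit) (fun δ => if δ = ∅ then 0 else p) (fun δ => δ.Nonempty) where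
  mono := fun γ _ x _ _ => Finset.insert_nonempty x γ
  not_empty := by simp
  top := Finset.univ_nonempty
  zero := by simp
  ne_zero := fun γ _ hγ => by simpa [hγ.ne_empty] using hp
  ne_top := fun γ _ hγ hne => (hne (by
    obtain ⟨x, hx⟩ := hγ
    ext y
    simpa using hx)).elim

/-- Indices on the ground set `X ∪ e` of one of the matroids of a 2-sum, in the dimension `2 h`,
for which the denominators that occur do not vanish. -/
structure GenericSummand (A : Matroid α) (e : α) (X : Finset α) (h : K) (a : α → K) : Prop where
  summand : TwoSummand A e
  ground : A.E \ {e} = X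
  half_ne_zero : h ≠ 0
  index_ne_zero : a e ≠ 0
  total : sdc A h a X + a e = h
  generic : ∀ γ ⊆ X, γ.Nonempty → ∀ n : ℤ, ∑ x ∈ γ, a x - h * n ≠ 0
  generic_insert : ∀ γ ⊆ X, γ ≠ X → ∀ n : ℤ, ∑ x ∈ γ, a x + a e - h * n ≠ 0

namespace GenericSummand

variable {A : Matroid α} {e : α} {X : Finset α} {h : K} {a : α → K}

theorem notMem (hA : GenericSummand A e X h a) : e ∉ X := by
  have h1 : e ∉ A.E \ {e} := fun h => h.2 rfl
  rwa [hA.ground, Finset.mem_coe] at h1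

theorem mem_closure (hA : GenericSummand A e X h a) : e ∈ A.closure X := by
  rw [← hA.ground]
  exact hA.summand.mem_closure_diff

theorem sdc_add_ne_zero (hA : GenericSummand A e X h a) {γ : Finset α} (hγ : γ ⊆ X)
    (he : e ∉ A.closure γ) : sdc A h a γ + a e ≠ 0 := by
  rw [sdc_coe, sub_add_eq_add_sub]
  exact_mod_cast hA.generic_insert γ hγ (fun h => he (h ▸ hA.mem_closure)) (corank A γ)

variable [DecidableEq α]

theorem ground_eq (hA : GenericSummand A e X h a) : A.E = (insert e X : Finset α) := by
  rw [Finset.coe_insert, ← hA.ground, Set.insert_sdiff_singleton,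
    Set.insert_eq_of_mem hA.summand.mem]

theorem subset_ground (hA : GenericSummand A e X h a) {γ : Finset α} (hγ : γ ⊆ X) :
    (γ : Set α) ⊆ A.E := by
  rw [hA.ground_eq, Finset.coe_subset]
  exact hγ.trans (Finset.subset_insert _ _)

open Classical in
theorem corank_insert (hA : GenericSummand A e X h a) {γ : Finset α} (hγ : γ ⊆ X) :
    corank A (insert e γ : Finset α) = corank A γ + if e ∈ A.closure γ then 1 else 0 := by
  rw [Finset.coe_insert]
  exact HeppBound.corank_insert γ.finite_toSet (hA.subset_ground hγ) hA.summand.mem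
    fun h => hA.notMem (hγ h)

theorem cut (hA : GenericSummand A e X h a) :
    Cut X (fun γ => sdc A h a γ) (fun γ => e ∈ A.closure γ) where
  mono := fun γ _ x _ hγ => A.closure_subset_closure (by simp) hγ
  not_empty := by simpa using hA.summand.notMem_closure_empty
  top := hA.mem_closure
  zero := by simp [sdc, corank_empty]
  ne_zero := fun γ hγ hne => by
    rw [sdc_coe]
    exact_mod_cast hA.generic γ hγ hne (corank A γ)
  ne_top := fun γ hγ _ hne => by
    -- The difference `u γ - u X` is, up to sign, the index sum of the complement minus `h` times a
    -- difference of coranks. This is why genericity is required for all integers.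
    have h1 := hA.generic (X \ γ) Finset.sdiff_subset
      (Finset.sdiff_nonempty.2 fun h => hne (hγ.antisymm h)) (corank A X - corank A γ : ℤ)
    rw [sdc_coe, sdc_coe, ← Finset.sum_sdiff hγ, ← neg_ne_zero]
    convert h1 using 1
    push_cast
    ring

-- By `total`, the jump `h` caused by the corank of `e` equals `u X + a e`, the correction that the
-- product theorem asks for.
open Classical in
theorem sdc_insert (hA : GenericSummand A e X h a) {γ : Finset α} (hγ : γ ⊆ X) :
    sdc A h a (insert e γ : Finset α) =
      sdc A h a γ + a e - if e ∈ A.closure γ then sdc A h a X + a e else 0 := by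
  rw [sdc_coe, hA.corank_insert hγ, Finset.sum_insert fun h => hA.notMem (hγ h), hA.total,
    sdc_coe]
  split_ifs <;> push_cast <;> ring

theorem sdc_insert_ne_zero (hA : GenericSummand A e X h a) {γ : Finset α} (hγ : γ ⊆ X)
    (hne : γ ≠ X) : sdc A h a (insert e γ : Finset α) ≠ 0 := by
  rw [hA.sdc_insert hγ]
  split_ifs with hs
  · rw [add_sub_add_right_eq_sub]
    exact hA.cut.ne_top γ hγ hs hne
  · rw [sub_zero]
    exact hA.sdc_add_ne_zero hγ hs

theorem corank_ground (hA : GenericSummand A e X h a) : corank A A.E = corank A X + 1 := by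
  rw [hA.ground_eq, hA.corank_insert subset_rfl, if_pos hA.mem_closure]

theorem halfDim_eq [CharZero K] (hA : GenericSummand A e X h a) : halfDim A a = h := by
  have h1 := hA.total
  rw [sdc_coe] at h1
  rw [halfDim, hA.corank_ground, hA.ground_eq, finsum_mem_coe_finset,
    Finset.sum_insert hA.notMem, div_eq_iff (Nat.cast_ne_zero.2 (Nat.succ_ne_zero _))]
  push_cast
  linear_combination h1

theorem denominatorsNonzero [CharZero K] (hA : GenericSummand A e X h a) :
    DenominatorsNonzero A a := by
  refine ⟨?_, ?_, ?_⟩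
  · rw [hA.corank_ground]
    exact Nat.cast_ne_zero.2 (Nat.succ_ne_zero _)
  · rw [hA.halfDim_eq]
    exact hA.half_ne_zero
  · intro γ hne hγ
    rw [hA.halfDim_eq]
    rw [hA.ground_eq] at hγ
    lift γ to Finset α using (Finset.finite_toSet _).subset hγ.subset
    rw [Finset.coe_ssubset] at hγ
    by_cases he : e ∈ γ
    · rw [← Finset.insert_erase he] at hγ ⊢
      refine hA.sdc_insert_ne_zero ?_ ?_
      · exact (Finset.insert_subset_insert_iff (Finset.notMem_erase _ _)).1 hγ.subset
      · intro h
        rw [h] at hγ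
        exact hγ.ne rfl
    · exact hA.cut.ne_zero γ ((Finset.subset_insert_iff_of_notMem he).1 hγ.subset)
        (Finset.coe_nonempty.1 hne)

/-- The subsets of `X ∪ e` form the product of the subsets of `X` with a one-point lattice of weight
`a e`, whose up-set is its top; the cut factor of the latter is `1`. -/
theorem hepp_eq [CharZero K] (hA : GenericSummand A e X h a) :
    hepp A a = ((a e)⁻¹ + (sdc A h a X)⁻¹) *
      cutSum X (fun γ => sdc A h a γ) (fun γ => e ∈ A.closure γ) := by
  classical
  set ω : Finset α → K := fun γ => sdc A h a γ with hω
  set p := a e with hp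
  have hω0 : ω ∅ = 0 := hA.cut.zero
  have h1 := sum_eq_cutSum_mul_cutSum hA.cut (cut_unit hA.index_ne_zero)
    (R := fun γ δ => chainSum ω (if δ = ∅ then γ else insert e γ)) ?_ ?_ ?_
  · rw [cutSum_unit, mul_one, if_neg Finset.univ_nonempty.ne_empty] at h1
    rw [← h1, hepp_eq_sum_chainSum hA.ground_eq (Finset.insert_nonempty _ _), hA.halfDim_eq,
      Finset.sum_insert hA.notMem, Finset.erase_insert hA.notMem, add_comm]
    congr 1
    swap
    · simp [hω]
    refine Finset.sum_congr rfl fun x hx => ?_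
    rw [if_neg Finset.univ_nonempty.ne_empty, Finset.erase_insert_of_ne]
    rintro rfl
    exact hA.notMem hx
  · simp [chainSum_empty]
  · intro γ hγ δ _ hst hne
    rcases δ.eq_empty_or_nonempty with rfl | hδ
    · rw [if_pos rfl, add_zero]
      exact hA.cut.ne_zero γ hγ (by simpa using hne)
    · rw [if_neg hδ.ne_empty]
      exact hA.sdc_add_ne_zero hγ fun h => hst ⟨h, hδ⟩
  · intro γ hγ δ _ hne hne'
    rcases δ.eq_empty_or_nonempty with rfl | hδ
    · simp only [Finset.not_nonempty_empty, and_false, if_false, if_true, Finset.sum_empty,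
        add_zero, sub_zero]
      exact hA.cut.mul_chainSum hγ
    · have hδ' : δ = Finset.univ := by
        obtain ⟨x, hx⟩ := hδ
        ext y
        simpa using hx
      subst hδ'
      have hγX : γ ≠ X := by simpa using hne'
      have heγ : e ∉ γ := fun h => hA.notMem (hγ h)
      have h2 := mul_chainSum hω0 (γ := insert e γ) fun _ => hA.sdc_insert_ne_zero hγ hγX
      rw [Finset.sum_insert heγ, Finset.erase_insert heγ, hω] at h2
      simp only [hA.sdc_insert hγ] at h2
      simp only [Finset.univ_nonempty, and_true, if_neg Finset.univ_nonempty.ne_empty]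
      rw [h2, add_comm]
      congr 1
      · refine Finset.sum_congr rfl fun x hx => ?_
        rw [Finset.erase_insert_of_ne]
        rintro rfl
        exact heγ hx
      · simp [hω]

theorem prod_index (hA : GenericSummand A e X h a) :
    ∏ᶠ x ∈ A.E, (h - a x) = (h - a e) * ∏ x ∈ X, (h - a x) := by
  rw [hA.ground_eq, finprod_mem_coe_finset, Finset.prod_insert hA.notMem]

end GenericSummand

end Summand

/-! ### The Hepp bound of the 2-sum -/

section TwoSum

theorem coe_disjSum {α β : Type*} (γ : Finset α) (δ : Finset β) :
    (γ.disjSum δ : Set (α ⊕ β)) = Sum.inl '' (γ : Set α) ∪ Sum.inr '' (δ : Set β) := by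
  ext (x | y) <;> simp

variable {α β K : Type*} [Field K]

variable {A : Matroid α} {B : Matroid β} {e : α} {f : β} {X : Finset α} {Y : Finset β} {h : K}
  {a : α → K} {b : β → K} {c : α ⊕ β → K}

theorem twoSum_ground (hA : TwoSummand A e) (hB : TwoSummand B f) (hX : A.E \ {e} = X)
    (hY : B.E \ {f} = Y) : (twoSum hA hB).E = (X.disjSum Y : Finset (α ⊕ β)) := by
  rw [coe_disjSum, ← hX, ← hY]
  rfl

open Classical in
theorem sdc_twoSum (hA : GenericSummand A e X h a) (hB : GenericSummand B f Y h b)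
    (ha : ∀ x ∈ X, a x = c (Sum.inl x)) (hb : ∀ y ∈ Y, b y = c (Sum.inr y))
    {γ : Finset α} {δ : Finset β} (hγ : γ ⊆ X) (hδ : δ ⊆ Y) :
    sdc (twoSum hA.summand hB.summand) h c (γ.disjSum δ : Finset (α ⊕ β)) =
      sdc A h a γ + sdc B h b δ - if e ∈ A.closure γ ∧ f ∈ B.closure δ then h else 0 := by
  rw [sdc_coe, sdc_coe, sdc_coe, coe_disjSum, corank_twoSum, Finset.sum_disjSum,
    Finset.sum_congr rfl fun x hx => ha x (hγ hx), Finset.sum_congr rfl fun y hy => hb y (hδ hy)]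
  · split_ifs <;> push_cast <;> ring
  · rwa [hA.ground, Finset.coe_subset]
  · rwa [hB.ground, Finset.coe_subset]

variable [DecidableEq α] [DecidableEq β]

theorem erase_disjSum_inl (γ : Finset α) (δ : Finset β) (x : α) :
    (γ.disjSum δ).erase (Sum.inl x) = (γ.erase x).disjSum δ := by
  ext (z | z) <;> simp

theorem erase_disjSum_inr (γ : Finset α) (δ : Finset β) (y : β) :
    (γ.disjSum δ).erase (Sum.inr y) = γ.disjSum (δ.erase y) := by
  ext (z | z) <;> simp

theorem hepp_twoSum (hA : GenericSummand A e X h a) (hB : GenericSummand B f Y h b)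
    (ha : ∀ x ∈ X, a x = c (Sum.inl x)) (hb : ∀ y ∈ Y, b y = c (Sum.inr y))
    (hae : a e = sdc B h b Y)
    (hh : halfDim (twoSum hA.summand hB.summand) c = h)
    (hne : ∀ S ⊆ X.disjSum Y, S.Nonempty → S ≠ X.disjSum Y →
      sdc (twoSum hA.summand hB.summand) h c S ≠ 0) :
    hepp (twoSum hA.summand hB.summand) c = ((sdc B h b Y)⁻¹ + (sdc A h a X)⁻¹) *
      (cutSum X (fun γ => sdc A h a γ) (fun γ => e ∈ A.closure γ) *
        cutSum Y (fun δ => sdc B h b δ) (fun δ => f ∈ B.closure δ)) := by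
  classical
  have hX : X.Nonempty := by
    have := hA.summand.diff_nonempty
    rwa [hA.ground, Finset.coe_nonempty] at this
  have htot : sdc A h a X + sdc B h b Y = h := by rw [← hae, hA.total]
  set ω : Finset (α ⊕ β) → K := fun S => sdc (twoSum hA.summand hB.summand) h c S with hω
  have hωe : ω ∅ = 0 := by
    simp only [hω, sdc_coe]
    simp [corank_empty]
  have hdne : ∀ {γ : Finset α} {δ : Finset β}, (γ.Nonempty ∨ δ.Nonempty) →
      (γ.disjSum δ).Nonempty := by
    rintro γ δ (⟨x, hx⟩ | ⟨y, hy⟩)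
    · exact ⟨Sum.inl x, Finset.inl_mem_disjSum.2 hx⟩
    · exact ⟨Sum.inr y, Finset.inr_mem_disjSum.2 hy⟩
  rw [← sum_eq_cutSum_mul_cutSum hA.cut hB.cut (R := fun γ δ => chainSum ω (γ.disjSum δ)),
    hepp_eq_sum_chainSum (twoSum_ground _ _ hA.ground hB.ground) (hdne (Or.inl hX)), hh,
    Finset.sum_disjSum]
  · simp only [erase_disjSum_inl, erase_disjSum_inr]
    rfl
  · simp [chainSum_empty]
  · intro γ hγ δ hδ hst hne'
    have h1 := hne _ (Finset.disjSum_mono hγ hδ) (hdne hne') ?_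
    · rwa [sdc_twoSum hA hB ha hb hγ hδ, if_neg hst, sub_zero] at h1
    · rw [Ne, Finset.disjSum_inj]
      rintro ⟨rfl, rfl⟩
      exact hst ⟨hA.mem_closure, hB.mem_closure⟩
  · intro γ hγ δ hδ hne' hne''
    rw [htot, ← sdc_twoSum hA hB ha hb hγ hδ]
    have h1 := mul_chainSum hωe (γ := γ.disjSum δ) fun hn =>
      hne _ (Finset.disjSum_mono hγ hδ) hn ?_
    · rw [Finset.sum_disjSum] at h1
      simpa only [erase_disjSum_inl, erase_disjSum_inr] using h1
    · rw [Ne, Finset.disjSum_inj]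
      tauto

end TwoSum

end HeppBound

namespace HeppBound

/-! ### Genericity of the indeterminate indices -/

section VarIndex

variable {α : Type*} {M : Matroid α} {E S : Finset α}

theorem eq_zero_of_varIndex_relation (hE : M.E = E) (hS : S ⊆ E) {q r : ℤ}
    (h : (q : IndexField M) * ∑ x ∈ S, varIndex M x - r * ∑ x ∈ E, varIndex M x = 0) {z : α}
    (hz : z ∈ E) : (z ∈ S → q = r) ∧ (z ∉ S → r = 0) := by
  classical
  let p : α → MvPolynomial M.E ℚ := fun x => if hx : x ∈ M.E then MvPolynomial.X ⟨x, hx⟩ else 0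
  have hp : ∀ x, varIndex M x = algebraMap (MvPolynomial M.E ℚ) (IndexField M) (p x) := by
    intro x
    simp only [varIndex, p]
    split_ifs <;> simp
  have h1 : (q : MvPolynomial M.E ℚ) * ∑ x ∈ S, p x - r * ∑ x ∈ E, p x = 0 := by
    apply IsFractionRing.injective (MvPolynomial M.E ℚ) (IndexField M)
    simp only [hp] at h
    simpa using h
  have hzE : z ∈ M.E := by rw [hE]; exact hz
  -- Evaluation at the unit vector of `z` reads off the coefficient of the variable `z`.
  let g : M.E → ℚ := Pi.single ⟨z, hzE⟩ 1
  have hg : ∀ x ∈ E, MvPolynomial.eval g (p x) = if x = z then 1 else 0 := by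
    intro x hx
    have hxE : x ∈ M.E := by rw [hE]; exact hx
    simp [p, hxE, g, Pi.single_apply]
  have h2 := congrArg (MvPolynomial.eval g) h1
  simp only [map_sub, map_mul, map_sum, map_intCast, map_zero] at h2
  rw [Finset.sum_congr rfl hg, Finset.sum_congr rfl fun x hx => hg x (hS hx)] at h2
  simp only [Finset.sum_ite_eq', if_pos hz, mul_one] at h2
  constructor
  · intro hzS
    rw [if_pos hzS, mul_one, sub_eq_zero] at h2
    exact_mod_cast h2
  · intro hzS
    rw [if_neg hzS, mul_zero, zero_sub, neg_eq_zero] at h2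
    exact_mod_cast h2

theorem halfDim_mul_corank {K : Type*} [Field K] [CharZero K] (hE : M.E = E)
    (hc : corank M M.E ≠ 0) (a : α → K) : halfDim M a * corank M M.E = ∑ x ∈ E, a x := by
  rw [halfDim, div_mul_cancel₀ _ (Nat.cast_ne_zero.2 hc), hE, finsum_mem_coe_finset]

theorem halfDim_varIndex_ne_zero (hE : M.E = E) (hne : E.Nonempty) (hc : corank M M.E ≠ 0) :
    halfDim M (varIndex M) ≠ 0 := by
  intro h
  have h1 := halfDim_mul_corank hE hc (varIndex M)
  rw [h, zero_mul] at h1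
  obtain ⟨z, hz⟩ := hne
  have := (eq_zero_of_varIndex_relation (q := 1) (r := 0) hE subset_rfl (by simp [← h1]) hz).1 hz
  simp at this

/-- After multiplication by the corank `L`, a vanishing value would be a linear relation with
coefficient `L - n` on `S` and `-n` off `S`. Both kinds of variables occur, so `L = n = 0`, but `L`
is positive. -/
theorem varIndex_generic (hE : M.E = E) (hc : corank M M.E ≠ 0) (hS : S ⊆ E)
    (hne : S.Nonempty) (hSE : S ≠ E) (n : ℤ) :
    ∑ x ∈ S, varIndex M x - halfDim M (varIndex M) * n ≠ 0 := by
  intro h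
  have h1 := halfDim_mul_corank hE hc (varIndex M)
  have h2 : (((corank M M.E : ℕ) : ℤ) : IndexField M) * ∑ x ∈ S, varIndex M x -
      n * ∑ x ∈ E, varIndex M x = 0 := by
    rw [← h1]
    push_cast
    linear_combination (corank M M.E : IndexField M) * h
  obtain ⟨x, hx⟩ := hne
  obtain ⟨y, hy, hyS⟩ := Finset.exists_of_ssubset (hS.ssubset_of_ne hSE)
  have h3 := (eq_zero_of_varIndex_relation hE hS h2 (hS hx)).1 hx
  have h4 := (eq_zero_of_varIndex_relation hE hS h2 hy).2 hyS
  omega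

end VarIndex

/-! ### Cut sums on two elements -/

section CutPair

variable {α K : Type*} [DecidableEq α] [Field K] {x y : α} {u : Finset α → K}
  {s : Finset α → Prop}

theorem sum_powerset_pair (hxy : x ≠ y) (f : Finset α → K) :
    ∑ γ ∈ ({x, y} : Finset α).powerset, f γ = f ∅ + f {y} + (f {x} + f {x, y}) := by
  rw [Finset.sum_powerset_insert (by simpa using hxy), show ({y} : Finset α) = insert y ∅ from rfl,
    Finset.sum_powerset_insert (Finset.notMem_empty _),
    Finset.sum_powerset_insert (Finset.notMem_empty _)]
  simp

/-- The up-set is entered only at the last step, so each order contributes the uncorrected weight of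
its first element. -/
theorem cutSum_pair_series (hxy : x ≠ y) (h0 : ¬ s ∅) (hx : ¬ s {x}) (hy : ¬ s {y})
    (h : s {x, y}) : cutSum {x, y} u s = (u {x})⁻¹ + (u {y})⁻¹ := by
  have h1 : ({x, y} : Finset α) \ {x} = {y} := by grind
  have h2 : ({x, y} : Finset α) \ {y} = {x} := by grind
  have h3 : ({y, x} : Finset α) = {x, y} := Finset.pair_comm _ _
  rw [cutSum, boundarySum, sum_powerset_pair hxy]
  simp [hxy, h0, hx, hy, h, h1, h2, h3, chainSum_singleton, cochainSum_self, add_comm]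

/-- The up-set is entered at the first step, so each order contributes the corrected weight of its
first element. -/
theorem cutSum_pair_parallel (hxy : x ≠ y) (h0 : ¬ s ∅) (hx : s {x}) (hy : s {y}) :
    cutSum {x, y} u s = (u {x} - u {x, y})⁻¹ + (u {y} - u {x, y})⁻¹ := by
  have h1 : ({x, y} : Finset α) \ {x} = {y} := by grind
  have h2 : ({x, y} : Finset α) \ {y} = {x} := by grind
  rw [cutSum, boundarySum, sum_powerset_pair hxy]
  simp [hxy, h0, hx, hy, h1, h2, chainSum_singleton, chainSum_empty, cochainSum]

end CutPair

end HeppBound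

namespace HeppBound

open Set

/-! ### Matching indices and dimensions of the two summands -/

section Generic

variable {α β : Type*} {A : Matroid α} {B : Matroid β} {e : α} {f : β}

theorem sdc_congr {K : Type*} [Field K] {h : K} {a a' : α → K} {γ : Set α}
    (haa : ∀ x ∈ γ, a x = a' x) : sdc A h a γ = sdc A h a' γ := by
  rw [sdc, sdc, finsum_mem_congr rfl haa]

theorem sdc_delete {K : Type*} [Field K] [DecidableEq α] {h : K} (a : α → K) (p : K) :
    sdc (A.delete {e}) h a (A.delete {e}).E = sdc A h (Function.update a e p) (A.E \ {e}) := by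
  rw [Matroid.delete_ground, sdc, corank_delete disjoint_sdiff_left, ← sdc]
  refine sdc_congr fun x hx => ?_
  rw [Function.update_of_ne hx.2]

theorem TwoSummand.exists_finset (hA : TwoSummand A e) :
    ∃ X : Finset α, A.E \ {e} = X := by
  have h := hA.finite.ground_finite.subset (sdiff_subset (t := {e}))
  exact ⟨h.toFinset, h.coe_toFinset.symm⟩

/-- The two summands with the indices that correspond to the indices `c` of the 2-sum, in the
dimension `2 h` of the 2-sum. -/
structure GenericPair {K : Type*} [Field K] (hA : TwoSummand A e) (hB : TwoSummand B f)
    (X : Finset α) (Y : Finset β) (h : K) (c : α ⊕ β → K) (a : α → K) (b : β → K) : Prop where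
  left : GenericSummand A e X h a
  right : GenericSummand B f Y h b
  left_eq : ∀ x ∈ X, a x = c (Sum.inl x)
  right_eq : ∀ y ∈ Y, b y = c (Sum.inr y)
  left_index : a e = sdc B h b Y
  right_index : b f = sdc A h a X
  halfDim_eq : halfDim (twoSum hA hB) c = h
  corank_ne_zero : corank (twoSum hA hB) (twoSum hA hB).E ≠ 0
  sdc_ne_zero : ∀ S ⊆ X.disjSum Y, S.Nonempty → S ≠ X.disjSum Y →
    sdc (twoSum hA hB) h c S ≠ 0

theorem corank_twoSum_ground (hA : TwoSummand A e) (hB : TwoSummand B f) {X : Finset α}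
    {Y : Finset β} (hX : A.E \ {e} = X) (hY : B.E \ {f} = Y) :
    corank (twoSum hA hB) (twoSum hA hB).E = corank A X + corank B Y + 1 := by
  rw [twoSum_ground hA hB hX hY, coe_disjSum, corank_twoSum hA hB hX.ge hY.ge, if_pos]
  rw [← hX, ← hY]
  exact ⟨hA.mem_closure_diff, hB.mem_closure_diff⟩

theorem genericPair {K : Type*} [Field K] [CharZero K] (hA : TwoSummand A e)
    (hB : TwoSummand B f) {X : Finset α} {Y : Finset β} {h : K} {c : α ⊕ β → K} {a : α → K}
    {b : β → K} (hX : A.E \ {e} = X) (hY : B.E \ {f} = Y)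
    (ha : ∀ x ∈ X, a x = c (Sum.inl x)) (hb : ∀ y ∈ Y, b y = c (Sum.inr y))
    (hae : a e = sdc B h b Y) (hbf : b f = sdc A h a X)
    (hh : halfDim (twoSum hA hB) c = h) (hne0 : h ≠ 0)
    (hc : ∀ S ⊆ X.disjSum Y, S.Nonempty → S ≠ X.disjSum Y → ∀ n : ℤ,
      ∑ z ∈ S, c z - h * n ≠ 0) :
    GenericPair hA hB X Y h c a b := by
  have hXne : X.Nonempty := by
    rw [← Finset.coe_nonempty, ← hX]
    exact hA.diff_nonempty
  have hYne : Y.Nonempty := by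
    rw [← Finset.coe_nonempty, ← hY]
    exact hB.diff_nonempty
  have hcor := corank_twoSum_ground hA hB hX hY
  have hcor0 : corank (twoSum hA hB) (twoSum hA hB).E ≠ 0 := by omega
  have hdim := halfDim_mul_corank (twoSum_ground hA hB hX hY) hcor0 c
  have hgen : ∀ γ ⊆ X, ∀ δ ⊆ Y, (γ.Nonempty ∨ δ.Nonempty) → (γ ≠ X ∨ δ ≠ Y) → ∀ n : ℤ,
      ∑ x ∈ γ, a x + ∑ y ∈ δ, b y - h * n ≠ 0 := by
    intro γ hγ δ hδ hne hne' n
    rw [Finset.sum_congr rfl fun x hx => ha x (hγ hx),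
      Finset.sum_congr rfl fun y hy => hb y (hδ hy), ← Finset.sum_disjSum]
    refine hc _ (Finset.disjSum_mono hγ hδ) ?_ ?_ n
    · rcases hne with ⟨x, hx⟩ | ⟨y, hy⟩
      · exact ⟨Sum.inl x, Finset.inl_mem_disjSum.2 hx⟩
      · exact ⟨Sum.inr y, Finset.inr_mem_disjSum.2 hy⟩
    · rw [Ne, Finset.disjSum_inj]
      tauto
  rw [hh, hcor, Finset.sum_disjSum, ← Finset.sum_congr rfl ha, ← Finset.sum_congr rfl hb] at hdim
  push_cast at hdim
  rw [sdc_coe] at hae hbf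
  refine
    { left := ⟨hA, hX, hne0, ?_, ?_, ?_, ?_⟩
      right := ⟨hB, hY, hne0, ?_, ?_, ?_, ?_⟩
      left_eq := ha
      right_eq := hb
      left_index := by rw [sdc_coe, hae]
      right_index := by rw [sdc_coe, hbf]
      halfDim_eq := hh
      corank_ne_zero := hcor0
      sdc_ne_zero := ?_ }
  · rw [hae]
    simpa using hgen ∅ (by simp) Y subset_rfl (Or.inr hYne) (Or.inl hXne.ne_empty.symm)
      (corank B Y)
  · rw [sdc_coe, hae]
    -- The corank of the 2-sum is that of `X` plus that of `Y` plus one. Its vanishing total degree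
    -- therefore says that `ω X + ω Y = h`, which puts both summands in the same dimension.
    linear_combination -hdim
  · intro γ hγ hne n
    simpa using hgen γ hγ ∅ (by simp) (Or.inl hne) (Or.inr hYne.ne_empty.symm) n
  · intro γ hγ hne n
    -- Since `a e` is `ω Y`, adding it amounts to enlarging the set by `Y` and the integer by the
    -- corank of `Y`.
    have h1 := hgen γ hγ Y subset_rfl (Or.inr hYne) (Or.inl hne) (corank B Y + n)
    rw [hae]
    convert h1 using 1
    push_cast
    ring
  · rw [hbf]
    simpa using hgen X subset_rfl ∅ (by simp) (Or.inl hXne) (Or.inr hYne.ne_empty.symm)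
      (corank A X)
  · rw [sdc_coe, hbf]
    linear_combination -hdim
  · intro δ hδ hne n
    simpa using hgen ∅ (by simp) δ hδ (Or.inr hne) (Or.inl hXne.ne_empty.symm) n
  · intro δ hδ hne n
    have h1 := hgen X subset_rfl δ hδ (Or.inl hXne) (Or.inr hne) (corank A X + n)
    rw [hbf]
    convert h1 using 1
    push_cast
    ring
  · intro S hS hne hne'
    rw [sdc_coe]
    exact_mod_cast hc S hS hne hne' (corank (twoSum hA hB) S)

end Generic

/-! ### The product formula -/

section Formulas

variable {α β K : Type*} [Field K] {A : Matroid α} {B : Matroid β} {e : α} {f : β}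
  {hA : TwoSummand A e} {hB : TwoSummand B f} {X : Finset α} {Y : Finset β} {h : K}
  {c : α ⊕ β → K} {a : α → K} {b : β → K}

namespace GenericPair

theorem denominatorsNonzero [CharZero K] (H : GenericPair hA hB X Y h c a b) :
    DenominatorsNonzero (twoSum hA hB) c := by
  refine ⟨Nat.cast_ne_zero.2 H.corank_ne_zero, ?_, ?_⟩
  · rw [H.halfDim_eq]
    exact H.left.half_ne_zero
  · intro S hne hS
    rw [H.halfDim_eq]
    rw [twoSum_ground hA hB H.left.ground H.right.ground] at hS
    lift S to Finset (α ⊕ β) using (Finset.finite_toSet _).subset hS.subset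
    rw [Finset.coe_ssubset] at hS
    exact H.sdc_ne_zero S hS.subset (Finset.coe_nonempty.1 hne) hS.ne

theorem prod_index (H : GenericPair hA hB X Y h c a b) :
    ∏ᶠ z ∈ (twoSum hA hB).E, (h - c z) = (∏ x ∈ X, (h - a x)) * ∏ y ∈ Y, (h - b y) := by
  rw [twoSum_ground hA hB H.left.ground H.right.ground, finprod_mem_coe_finset, Finset.prod_disjSum,
    Finset.prod_congr rfl fun x hx => congrArg (h - ·) (H.left_eq x hx),
    Finset.prod_congr rfl fun y hy => congrArg (h - ·) (H.right_eq y hy)]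

theorem hepp_eq [DecidableEq α] [DecidableEq β] (H : GenericPair hA hB X Y h c a b) :
    hepp (twoSum hA hB) c = ((a e)⁻¹ + (b f)⁻¹) *
      (cutSum X (fun γ => sdc A h a γ) (fun γ => e ∈ A.closure γ) *
        cutSum Y (fun δ => sdc B h b δ) (fun δ => f ∈ B.closure δ)) := by
  rw [hepp_twoSum H.left H.right H.left_eq H.right_eq H.left_index H.halfDim_eq H.sdc_ne_zero,
    H.left_index, H.right_index]

variable [CharZero K]

theorem hepp_left [DecidableEq α] (H : GenericPair hA hB X Y h c a b) :
    hepp A a = ((a e)⁻¹ + (b f)⁻¹) *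
      cutSum X (fun γ => sdc A h a γ) (fun γ => e ∈ A.closure γ) := by
  rw [H.left.hepp_eq, H.right_index]

theorem hepp_right [DecidableEq β] (H : GenericPair hA hB X Y h c a b) :
    hepp B b = ((a e)⁻¹ + (b f)⁻¹) *
      cutSum Y (fun δ => sdc B h b δ) (fun δ => f ∈ B.closure δ) := by
  rw [H.right.hepp_eq, H.left_index, add_comm]

variable [DecidableEq α] [DecidableEq β]

theorem hepp_eq_hepp_left_mul (H : GenericPair hA hB X Y h c a b) :
    hepp (twoSum hA hB) c =
      cutSum Y (fun δ => sdc B h b δ) (fun δ => f ∈ B.closure δ) * hepp A a := by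
  rw [H.hepp_eq, H.hepp_left]
  ring

theorem heppPos_mul (H : GenericPair hA hB X Y h c a b) :
    heppPos (twoSum hA hB) c = heppPos A a * heppPos B b := by
  have h1 := H.left.total
  rw [← H.right_index] at h1
  have h2 := H.left.index_ne_zero
  have h3 := H.right.index_ne_zero
  have h4 := H.left.half_ne_zero
  rw [heppPos, heppPos, heppPos, H.halfDim_eq, H.left.halfDim_eq, H.right.halfDim_eq,
    H.prod_index, H.left.prod_index, H.right.prod_index, H.hepp_eq, H.hepp_left, H.hepp_right]
  have h5 : h - a e = b f := by rw [← h1]; ring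
  have h6 : h - b f = a e := by rw [← h1]; ring
  -- The common prefactor supplies the `h` that cancels the normalization `1 / h` in each
  -- position-space bound.
  have h7 : (a e)⁻¹ + (b f)⁻¹ = h / (a e * b f) := by
    rw [← h1]
    field_simp
  rw [h5, h6, h7]
  field_simp

end GenericPair

end Formulas

/-! ### The uniform matroids on three elements -/

section Uniform

theorem corank_of_indep {α : Type*} {M : Matroid α} {I : Set α} (hI : M.Indep I) :
    corank M I = 0 := by
  rw [corank, hI.eRk_eq_encard, ncard_def, Nat.sub_self]

theorem uniform_ground (r : ℕ) :
    (uniform 3 r).E \ {2} = (({0, 1} : Finset (Fin 3)) : Set (Fin 3)) := by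
  have h : (uniform 3 r).E = univ := rfl
  rw [h]
  ext i
  fin_cases i <;> simp

theorem uniform_mem_closure_iff {n r : ℕ} {i : Fin n} {I : Finset (Fin n)} (hI : I.card ≤ r)
    (hi : i ∉ I) : i ∈ (uniform n r).closure I ↔ r < (insert i I).card := by
  have h1 : (uniform n r).Indep I := by
    rwa [uniform_indep_iff, ncard_coe_finset]
  rw [← not_iff_not, h1.notMem_closure_iff_of_notMem (by simpa using hi) (mem_univ i),
    uniform_indep_iff, ← Finset.coe_insert, ncard_coe_finset, not_lt]

theorem corank_uniform_of_card_le {n r : ℕ} {I : Finset (Fin n)} (hI : I.card ≤ r) :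
    corank (uniform n r) I = 0 :=
  corank_of_indep (by rwa [uniform_indep_iff, ncard_coe_finset])

theorem corank_uniform_one_pair :
    corank (uniform 3 1) (({0, 1} : Finset (Fin 3)) : Set (Fin 3)) = 1 := by
  classical
  rw [Finset.coe_insert, corank_insert (Finset.finite_toSet _) (subset_univ _) (mem_univ _)
    (by simp), corank_uniform_of_card_le (by simp), if_pos]
  rw [uniform_mem_closure_iff (by simp) (by simp)]
  simp

variable {K : Type*} [Field K]

theorem cutSum_uniform_two {h : K} {b : Fin 3 → K} :
    cutSum ({0, 1} : Finset (Fin 3)) (fun δ => sdc (uniform 3 2) h b δ)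
      (fun δ => 2 ∈ (uniform 3 2).closure δ) =
      (b 0)⁻¹ + (b 1)⁻¹ := by
  rw [cutSum_pair_series (by decide)]
  · rw [sdc_coe, sdc_coe, corank_uniform_of_card_le (by simp), corank_uniform_of_card_le (by simp)]
    simp
  all_goals
    rw [uniform_mem_closure_iff (by decide) (by decide)]
    decide

theorem cutSum_uniform_one {h : K} {b : Fin 3 → K} :
    cutSum ({0, 1} : Finset (Fin 3)) (fun δ => sdc (uniform 3 1) h b δ)
      (fun δ => 2 ∈ (uniform 3 1).closure δ) =
      (h - b 1)⁻¹ + (h - b 0)⁻¹ := by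
  rw [cutSum_pair_parallel (by decide)]
  · rw [sdc_coe, sdc_coe, sdc_coe, corank_uniform_one_pair,
      corank_uniform_of_card_le (I := {0}) (by simp),
      corank_uniform_of_card_le (I := {1}) (by simp)]
    simp only [Finset.sum_singleton, Finset.sum_pair (show (0 : Fin 3) ≠ 1 by decide)]
    push_cast
    congr 2 <;> ring
  all_goals
    rw [uniform_mem_closure_iff (by decide) (by decide)]
    decide

end Uniform

/-! ### Specialization to indeterminates -/

section Indeterminate

variable {α β : Type*} {A : Matroid α} {B : Matroid β} {e : α} {f : β}

theorem genericPair_varIndex (hA : TwoSummand A e) (hB : TwoSummand B f) {X : Finset α}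
    {Y : Finset β} {a : α → IndexField (twoSum hA hB)} {b : β → IndexField (twoSum hA hB)}
    (hX : A.E \ {e} = X) (hY : B.E \ {f} = Y)
    (ha : ∀ x ∈ X, a x = varIndex (twoSum hA hB) (Sum.inl x))
    (hb : ∀ y ∈ Y, b y = varIndex (twoSum hA hB) (Sum.inr y))
    (hae : a e = sdc B (halfDim (twoSum hA hB) (varIndex (twoSum hA hB))) b Y)
    (hbf : b f = sdc A (halfDim (twoSum hA hB) (varIndex (twoSum hA hB))) a X) :
    GenericPair hA hB X Y (halfDim (twoSum hA hB) (varIndex (twoSum hA hB)))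
      (varIndex (twoSum hA hB)) a b := by
  have hE := twoSum_ground hA hB hX hY
  have hcor := corank_twoSum_ground hA hB hX hY
  have hcor0 : corank (twoSum hA hB) (twoSum hA hB).E ≠ 0 := by omega
  refine genericPair hA hB hX hY ha hb hae hbf rfl (halfDim_varIndex_ne_zero hE ?_ hcor0)
    fun S hS hne hne' n => varIndex_generic hE hcor0 hS hne hne' n
  obtain ⟨x, hx⟩ := hA.diff_nonempty
  exact ⟨Sum.inl x, Finset.inl_mem_disjSum.2 (hX.le hx)⟩

theorem exists_genericPair_uniform [DecidableEq α] {r : ℕ} (h0 : 0 < r) (h3 : r < 3)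
    (hA : TwoSummand A e) {X : Finset α} (hX : A.E \ {e} = X)
    {p : IndexField (twoSum hA (uniform_twoSummand h0 h3 2))}
    (hp : p = varIndex (twoSum hA (uniform_twoSummand h0 h3 2)) (Sum.inr 0) +
      varIndex (twoSum hA (uniform_twoSummand h0 h3 2)) (Sum.inr 1) -
        halfDim (twoSum hA (uniform_twoSummand h0 h3 2))
          (varIndex (twoSum hA (uniform_twoSummand h0 h3 2))) *
        (corank (uniform 3 r) (({0, 1} : Finset (Fin 3)) : Set (Fin 3)) : ℕ)) :
    ∃ b, b 0 = varIndex (twoSum hA (uniform_twoSummand h0 h3 2)) (Sum.inr 0) ∧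
      b 1 = varIndex (twoSum hA (uniform_twoSummand h0 h3 2)) (Sum.inr 1) ∧
      GenericPair hA (uniform_twoSummand h0 h3 2) X {0, 1}
        (halfDim (twoSum hA (uniform_twoSummand h0 h3 2))
          (varIndex (twoSum hA (uniform_twoSummand h0 h3 2))))
        (varIndex (twoSum hA (uniform_twoSummand h0 h3 2)))
        (Function.update (fun x => varIndex (twoSum hA (uniform_twoSummand h0 h3 2)) (Sum.inl x))
          e p) b := by
  refine ⟨Function.update
    (fun y => varIndex (twoSum hA (uniform_twoSummand h0 h3 2)) (Sum.inr y)) 2 _,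
    Function.update_of_ne (by decide) _ _, Function.update_of_ne (by decide) _ _,
    genericPair_varIndex hA _ hX (uniform_ground r)
      (fun x hx => Function.update_of_ne (hX.ge hx).2 _ _)
      (fun y hy => Function.update_of_ne ?_ _ _) ?_ (Function.update_self _ _ _)⟩
  · rintro rfl
    simp at hy
  · rw [Function.update_self, hp, sdc_coe, Finset.sum_pair (by decide),
      Function.update_of_ne (by decide), Function.update_of_ne (by decide)]

end Indeterminate

end HeppBound

theorem mainTheorem6 {α β : Type*} [DecidableEq α] [DecidableEq β]
    (A : Matroid α) (B : Matroid β) (e : α) (f : β)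
    (hA : HeppBound.TwoSummand A e) (hB : HeppBound.TwoSummand B f) :
    -- the product formula for the 2-sum, as an identity of rational functions
    (let M := HeppBound.twoSum hA hB
     let c := HeppBound.varIndex M
     let h := HeppBound.halfDim M c
     let a := fun x : α => c (Sum.inl x)
     let b := fun y : β => c (Sum.inr y)
     let a' := Function.update a e (HeppBound.sdc (B.delete {f}) h b (B.delete {f}).E)
     let b' := Function.update b f (HeppBound.sdc (A.delete {e}) h a (A.delete {e}).E)
     HeppBound.DenominatorsNonzero M c ∧
     HeppBound.DenominatorsNonzero A a' ∧
     HeppBound.DenominatorsNonzero B b' ∧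
     HeppBound.heppPos M c = HeppBound.heppPos A a' * HeppBound.heppPos B b') ∧
    -- series reduction
    (let S := HeppBound.twoSum hA
        (HeppBound.uniform_twoSummand (r := 2) (by norm_num) (by norm_num) 2)
     let c := HeppBound.varIndex S
     let a := fun x : α => c (Sum.inl x)
     let a₁ := c (Sum.inr 0)
     let a₂ := c (Sum.inr 1)
     HeppBound.hepp S c =
       (a₁ + a₂) / (a₁ * a₂) * HeppBound.hepp A (Function.update a e (a₁ + a₂))) ∧
    -- parallel reduction
    (let P := HeppBound.twoSum hA
        (HeppBound.uniform_twoSummand (r := 1) (by norm_num) (by norm_num) 2)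
     let c := HeppBound.varIndex P
     let h := HeppBound.halfDim P c
     let a := fun x : α => c (Sum.inl x)
     let a₁ := c (Sum.inr 0)
     let a₂ := c (Sum.inr 1)
     HeppBound.hepp P c =
       ((h - a₁) + (h - a₂)) / ((h - a₁) * (h - a₂)) *
         HeppBound.hepp A (Function.update a e (a₁ + a₂ - h)) ∧
     HeppBound.heppPos P c =
       HeppBound.heppPos A (Function.update a e (a₁ + a₂ - h))) := by
  obtain ⟨X, hX⟩ := hA.exists_finset
  refine ⟨?_, ?_, ?_⟩
  · obtain ⟨Y, hY⟩ := hB.exists_finset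
    intro M c h a b a' b'
    have H : HeppBound.GenericPair hA hB X Y h c a' b' :=
      HeppBound.genericPair_varIndex hA hB hX hY
        (fun x hx => Function.update_of_ne (hX.ge hx).2 _ _)
        (fun y hy => Function.update_of_ne (hY.ge hy).2 _ _)
        (by rw [← hY, ← HeppBound.sdc_delete]; exact Function.update_self _ _ _)
        (by rw [← hX, ← HeppBound.sdc_delete]; exact Function.update_self _ _ _)
    exact ⟨H.denominatorsNonzero, H.left.denominatorsNonzero, H.right.denominatorsNonzero,
      H.heppPos_mul⟩
  · intro S c a a₁ a₂
    -- The index of `e` is `ω` of the two new elements; they are independent in `uniform 3 2`, so no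
    -- multiple of `h` is subtracted.
    obtain ⟨b, hb0, hb1, H⟩ := HeppBound.exists_genericPair_uniform (r := 2) (by norm_num)
      (by norm_num) hA hX (p := a₁ + a₂)
      (by rw [HeppBound.corank_uniform_of_card_le (by simp), Nat.cast_zero, mul_zero, sub_zero])
    have h1 : a₁ ≠ 0 := by
      have := H.right.generic {0} (by simp) (by simp) 0
      rwa [Finset.sum_singleton, Int.cast_zero, mul_zero, sub_zero, hb0] at this
    have h2 : a₂ ≠ 0 := by
      have := H.right.generic {1} (by simp) (by simp) 0
      rwa [Finset.sum_singleton, Int.cast_zero, mul_zero, sub_zero, hb1] at this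
    have h3 := H.hepp_eq_hepp_left_mul
    rw [HeppBound.cutSum_uniform_two, hb0, hb1] at h3
    refine h3.trans ?_
    congr 1
    change a₁⁻¹ + a₂⁻¹ = (a₁ + a₂) / (a₁ * a₂)
    field_simp
    ring
  · intro P c h a a₁ a₂
    -- The two new elements form a circuit in `uniform 3 1`, so their `ω` is the sum of the indices
    -- minus `h`.
    obtain ⟨b, hb0, hb1, H⟩ := HeppBound.exists_genericPair_uniform (r := 1) (by norm_num)
      (by norm_num) hA hX (p := a₁ + a₂ - h)
      (by rw [HeppBound.corank_uniform_one_pair, Nat.cast_one, mul_one])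
    have h1 : h - a₁ ≠ 0 := by
      have := H.right.generic {0} (by simp) (by simp) 1
      rw [Finset.sum_singleton, Int.cast_one, mul_one, hb0] at this
      exact sub_ne_zero.2 (sub_ne_zero.1 this).symm
    have h2 : h - a₂ ≠ 0 := by
      have := H.right.generic {1} (by simp) (by simp) 1
      rw [Finset.sum_singleton, Int.cast_one, mul_one, hb1] at this
      exact sub_ne_zero.2 (sub_ne_zero.1 this).symm
    have h3 := H.hepp_eq_hepp_left_mul
    rw [HeppBound.cutSum_uniform_one, hb0, hb1] at h3
    have h4 : HeppBound.hepp P c = ((h - a₁) + (h - a₂)) / ((h - a₁) * (h - a₂)) *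
        HeppBound.hepp A (Function.update a e (a₁ + a₂ - h)) := by
      refine h3.trans ?_
      congr 1
      change (h - a₂)⁻¹ + (h - a₁)⁻¹ = (h - a₁ + (h - a₂)) / ((h - a₁) * (h - a₂))
      field_simp
    refine ⟨h4, ?_⟩
    -- Both normalizations share the product over `X`. The remaining factor for `P` cancels the
    -- denominator of the reduction factor, and its numerator equals `h - (a₁ + a₂ - h)`, the factor
    -- of `e` in `A`.
    have h5 := H.prod_index
    rw [Finset.prod_pair (by decide), hb0, hb1] at h5
    have h6 := H.left.prod_index
    rw [Function.update_self] at h6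
    have h7 := H.left.half_ne_zero
    rw [HeppBound.heppPos, HeppBound.heppPos, H.left.halfDim_eq, h4]
    change (∏ᶠ x ∈ P.E, (h - c x)) / h * _ = (∏ᶠ x ∈ A.E, _) / h * _
    refine (congrArg₂ (fun x y => x / h * y) h5 rfl).trans ?_
    refine Eq.trans ?_ (congrArg₂ (fun x y => x / h * y) h6 rfl).symm
    change _ * ((h - a₁) * (h - a₂)) / h * _ = _
    generalize (∏ x ∈ X, (h - Function.update a e (a₁ + a₂ - h) x)) = Q
    field_simp
    ring
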